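/- A virtual knot diagram is a diagram in the plane of one closed curve whose double points are classical crossings (with over/under information) or virtual crossings; two such diagrams are virtually equivalent if they are related by planar isotopy, the classical Reidemeister moves I, II, III, the virtual Reidemeister moves I, II, III (all crossings virtual), and the mixed third move (a strand with two virtual crossings passes a classical crossing). For a nonempty virtual link diagram $K$ let $$\langle K\rangle=\sum_{s}A^{c(s)}d^{|s|-1}\in\mathbb Z[A,A^{-1}],\qquad d=-A^{2}-A^{-2},$$ where $s$ runs over the states of $K$ (a choice of the smoothing $\alpha$ or $\beta$ at every classical crossing, the virtual crossings being kept), $c(s)$ is the number of $\alpha$-smoothings minus the number of $\beta$-smoothings, and $|s|$ is the number of closed curves of $s$. Let $\langle K\rangle_N=\langle K_N\rangle$, where $K_N$ consists of $N$ parallel copies of $K$ (each classical or virtual crossing is replaced by $N^2$ crossings of the same kind). Let $K_D$ be the virtual knot diagram with eight classical and two virtual crossings whose signed Gauss code (the sequence of over- and under-passages through the classical crossings, with the signs of the crossings) is $$U_1^+O_2^+O_1^+O_3^-U_4^-U_2^+O_4^-U_3^-\;U_5^+O_6^+U_7^-U_6^+O_5^+O_8^-O_7^-U_8^- ;$$ it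 is the closure of the composition of two $1$-$1$ tangles (crossings $1$ to $4$ and $5$ to $8$), each with one virtual crossing, which lies on the arc from $O_2$ to $O_1$ and on the arc from $U_2$ to $O_4$ in the first tangle, and on the arc from $O_6$ to $U_7$ and on the arc from $O_8$ to $O_7$ in the second one. Then $\langle K_D\rangle=1$ and $\langle K_D\rangle_2=d$, which are also the values of the crossingless diagram $U$ of the unknot: $\langle U\rangle=1$, $\langle U\rangle_2=d$, $\langle U\rangle_3=d^2$. However, with $s_k=A^k+A^{-k}$, $$\langle K_D\rangle_3=d\,\bigl( -1842 +s_{76} -2s_{72} -2s_{70} -3s_{68} -8s_{66} -18s_{64} -17s_{62} -8s_{60} -5s_{58} -2s_{56} +21s_{54} +66s_{52} +95s_{50} +103s_{48} +114s_{46} +136s_{44} +111s_{42} +11s_{40} -110s_{38} -209s_{36} -326s_{34} -491s_{32} -601s_{30} -559s_{28} -380s_{26} -178s_{24} +142s_{22} +594s_{20} +1050s_{18} +1329s_{16} +1334s_{14} +1215s_{12} +814s_{10} +193s_{8} -573s_{6} -1257s_{4} -1660s_{2} \bigr),$$ so that $\langle K_D\rangle_3\neq d^2$. Moreover $K_D$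 is not virtually equivalent to the unknot. -/

import Mathlib

open scoped LaurentPolynomial

namespace VirtualKnot

/-! ### Virtual diagrams in the plane

A virtual link diagram in the plane is put in general position with respect to the height function
and read from bottom to top.  It becomes a list of layers; each layer contains one local minimum,
one local maximum, one classical crossing or one virtual crossing, and all the other strands run
vertically.  The strands at a given height are numbered `0, 1, 2, …` from left to right. -/

/-- The crossings of a virtual diagram.  Both strands rise.
* `over`: classical, the strand from the lower left to the upper right passes over the other one;
* `under`: classical, the strand from the lower left to the upper right passes under the other one;
* `virt`: virtual. -/
inductive Crossing
  | over
  | under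
  | virt

/-- Exchange the roles of the two strands of a crossing. -/
def Crossing.switch : Crossing → Crossing
  | .over => .under
  | .under => .over
  | .virt => .virt

/-- The pieces of a diagram: a local minimum `cup`, a local maximum `cap`, or a crossing. -/
inductive Piece
  | cup
  | cap
  | cross (c : Crossing)

/-- The number of strands that enter a piece from below. -/
def Piece.inputs : Piece → ℕ
  | .cup => 0
  | .cap => 2
  | .cross _ => 2

/-- The number of strands that leave a piece at the top. -/
def Piece.outputs : Piece → ℕ
  | .cup => 2
  | .cap => 0
  | .cross _ => 2

/-- `(p, i)` is the layer with the piece `p` that has exactly `i` strands to the left of `p`. -/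
abbrev Layer := Piece × ℕ

/-- A list of layers, from bottom to top. -/
abbrev Word := List Layer

/-- A local minimum with `i` strands to its left. -/
abbrev cup (i : ℕ) : Layer := (Piece.cup, i)

/-- A local maximum with `i` strands to the left of it; it joins the strands `i` and `i + 1`. -/
abbrev cap (i : ℕ) : Layer := (Piece.cap, i)

/-- A crossing of the strands `i` and `i + 1`. -/
abbrev cross (c : Crossing) (i : ℕ) : Layer := (Piece.cross c, i)

/-- The number of strands above a layer with `n` strands below it; `none` if the layer does not
fit on `n` strands. -/
def Layer.width (l : Layer) (n : ℕ) : Option ℕ :=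
  if l.2 + l.1.inputs ≤ n then some (n - l.1.inputs + l.1.outputs) else none

/-- The number of strands above a word with `n` strands below it; `none` if the layers do not fit
together. -/
def Word.width : Word → ℕ → Option ℕ
  | [], n => some n
  | l :: w, n => (Layer.width l n).bind (Word.width w)

/-- A word is a closed diagram if its layers fit together and it has no free ends. -/
def Word.IsClosed (w : Word) : Prop := Word.width w 0 = some 0

/-- Count the closed curves of a word, where strands go straight through all crossings.  The list
`s` gives, from left to right, for each strand at the current height the label of the arc (of the
part of the diagram below) to which it belongs; `k` is the next label not yet in use.  A local
maximum that joins two ends of one arc closes a curve, otherwise it merges two arcs. -/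
def curvesFrom : Word → List ℕ → ℕ → ℕ
  | [], _, _ => 0
  | (.cup, i) :: w, s, k => curvesFrom w (s.take i ++ k :: k :: s.drop i) (k + 1)
  | (.cap, i) :: w, s, k =>
    match s.drop i with
    | a :: b :: t =>
      (if a = b then 1 else 0)
        + curvesFrom w ((s.take i ++ t).map fun c => if c = b then a else c) k
    | _ => 0
  | (.cross _, i) :: w, s, k =>
    match s.drop i with
    | a :: b :: t => curvesFrom w (s.take i ++ b :: a :: t) k
    | _ => 0

/-- The number of closed curves of a closed diagram, where strands go straight through all
crossings, classical or virtual. -/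
def Word.curves (w : Word) : ℕ := curvesFrom w [] 0

/-- A virtual knot diagram: a diagram in the plane of a single closed curve, with classical and
virtual crossings. -/
@[ext]
structure VirtualKnotDiagram where
  /-- the layers, from bottom to top -/
  word : Word
  isClosed : word.IsClosed
  isKnot : word.curves = 1

/-! ### Virtual equivalence -/

/-- The third Reidemeister moves.  The arguments are the crossing of strands 1 and 2, of strands
1 and 3, and of strands 2 and 3 of three strands that cross pairwise.  The move is allowed if all
three crossings are classical and one strand is on top, one in the middle and one at the bottom;
or if all three are virtual; or if exactly two of them are virtual (a strand with only virtual
crossings moves past a classical crossing).  Two classical and one virtual crossing are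
forbidden. -/
def ThirdMoveAllowed : Crossing → Crossing → Crossing → Prop
  | .virt, .virt, _ => True
  | .virt, _, .virt => True
  | _, .virt, .virt => True
  | .virt, _, _ => False
  | _, .virt, _ => False
  | _, _, .virt => False
  | .over, .under, .over => False
  | .under, .over, .under => False
  | _, _, _ => True

/-- The local moves.  The first five generate planar isotopy, the others are the classical,
virtual and mixed Reidemeister moves. -/
inductive LocalMove : Word → Word → Prop
  /-- two pieces next to each other exchange their heights; `k` strands run between them -/
  | exchange (p q : Piece) (i k : ℕ) :
      LocalMove [(p, i), (q, i + p.outputs + k)] [(q, i + p.inputs + k), (p, i)]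
  /-- straighten a strand -/
  | zigzag_left (i : ℕ) : LocalMove [cup i, cap (i + 1)] []
  /-- straighten a strand -/
  | zigzag_right (i : ℕ) : LocalMove [cup (i + 1), cap i] []
  /-- slide a crossing through a local minimum -/
  | slide_cup (c : Crossing) (i : ℕ) :
      LocalMove [cup i, cross c (i + 1)] [cup (i + 1), cross c.switch i]
  /-- slide a crossing through a local maximum -/
  | slide_cap (c : Crossing) (i : ℕ) :
      LocalMove [cross c (i + 1), cap i] [cross c.switch i, cap (i + 1)]
  /-- first move, classical and virtual -/
  | first_cup (c : Crossing) (i : ℕ) : LocalMove [cup i, cross c i] [cup i]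
  /-- first move, classical and virtual -/
  | first_cap (c : Crossing) (i : ℕ) : LocalMove [cross c i, cap i] [cap i]
  /-- second move, classical and virtual -/
  | second (c : Crossing) (i : ℕ) : LocalMove [cross c i, cross c.switch i] []
  /-- third move, classical, virtual and mixed -/
  | third (c₁₂ c₁₃ c₂₃ : Crossing) (h : ThirdMoveAllowed c₁₂ c₁₃ c₂₃) (i : ℕ) :
      LocalMove [cross c₁₂ i, cross c₁₃ (i + 1), cross c₂₃ i]
        [cross c₂₃ (i + 1), cross c₁₃ i, cross c₁₂ (i + 1)]

/-- `K'` arises from `K` by one local move applied to some consecutive layers. -/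
def Step (K K' : VirtualKnotDiagram) : Prop :=
  ∃ u l r v : Word, LocalMove l r ∧ K.word = u ++ l ++ v ∧ K'.word = u ++ r ++ v

/-- Virtual equivalence: a finite sequence of local moves and their inverses transforms `K` into
`K'`. -/
def VirtuallyEquivalent : VirtualKnotDiagram → VirtualKnotDiagram → Prop :=
  Relation.EqvGen Step

/-! ### The bracket polynomial -/

/-- The two smoothings of a layer with a classical crossing, each with its contribution to
`#α - #β`, where `α` is the smoothing that joins the two regions swept out by the over-crossing
strand when it is turned counterclockwise; it has weight `1` and `β` has weight `-1`.  Two vertical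
strands are the empty word, and a maximum below a minimum is `[cap i, cup i]`.  Layers without a
classical crossing are left as they are. -/
def smoothings : Layer → List (Word × ℤ)
  | (.cross .over, i) => [([], 1), ([cap i, cup i], -1)]
  | (.cross .under, i) => [([cap i, cup i], 1), ([], -1)]
  | l => [([l], 0)]

/-- All states `s` of a diagram, one for each choice of a smoothing at every classical crossing,
each with the number `c(s)` of smoothings of type `α` minus the number of those of type `β`. -/
def states : Word → List (Word × ℤ)
  | [] => [([], 0)]
  | l :: w =>
    (smoothings l).flatMap fun a => (states w).map fun b => (a.1 ++ b.1, a.2 + b.2)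

/-- `d = -A⁻² - A²`, where `A` is the variable `LaurentPolynomial.T 1`. -/
noncomputable def d : ℤ[T;T⁻¹] := -LaurentPolynomial.T (-2) - LaurentPolynomial.T 2

/-- The bracket polynomial `∑ₛ A^{c(s)} d^{|s| - 1}` of a (nonempty) virtual link diagram, where
`|s|` is the number of closed curves of the state `s`. -/
noncomputable def bracket (w : Word) : ℤ[T;T⁻¹] :=
  ((states w).map fun s => LaurentPolynomial.T s.2 * d ^ (s.1.curves - 1)).sum

/-- The `N` parallel copies of a layer: `N` nested minima or maxima, or `N²` crossings of the same
kind, where `N` parallel strands cross `N` parallel strands. -/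
def Layer.parallel (N : ℕ) : Layer → Word
  | (.cup, i) => (List.range N).map fun a => cup (N * i + a)
  | (.cap, i) => (List.range N).map fun a => cap (N * i + (N - 1 - a))
  | (.cross c, i) =>
    (List.range N).flatMap fun a =>
      (List.range N).map fun b => cross c (N * i + a + (N - 1 - b))

/-- The virtual link diagram `K_N` formed by `N` parallel copies of a diagram `K`. -/
def Word.parallel (N : ℕ) (w : Word) : Word := w.flatMap (Layer.parallel N)

/-- The bracket polynomial `⟨K⟩` of a virtual knot diagram. -/
noncomputable def VirtualKnotDiagram.bracket (K : VirtualKnotDiagram) : ℤ[T;T⁻¹] :=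
  VirtualKnot.bracket K.word

/-- The `N`-strand bracket polynomial `⟨K⟩_N = ⟨K_N⟩`, for `N ≥ 1`. -/
noncomputable def VirtualKnotDiagram.strandBracket (N : ℕ) (K : VirtualKnotDiagram) : ℤ[T;T⁻¹] :=
  VirtualKnot.bracket (K.word.parallel N)

/-! ### The unknot and the diagram `K_D` -/

/-- The diagram of the unknot without crossings. -/
def unknot : VirtualKnotDiagram where
  word := [cup 0, cap 0]
  isClosed := by rfl
  isKnot := by rfl

/-- The diagram `K_D`, with eight classical and two virtual crossings.  It is the closure of the
composition of two `1`-`1` tangles with four classical crossings and one virtual crossing each.  Its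
signed Gauss code is
`U1+ O2+ O1+ O3- U4- U2+ O4- U3- U5+ O6+ U7- U6+ O5+ O8- O7- U8-`. -/
def KD : VirtualKnotDiagram where
  word :=
    [cup 0,
      cup 0, cup 1, cross .virt 0,
      cross .over 1, cross .over 0, cross .over 0, cross .over 1,
      cap 2, cap 1,
      cup 0, cup 1, cross .virt 2,
      cross .under 1, cross .under 2, cross .under 2, cross .under 1,
      cap 0, cap 1,
      cap 0]
  isClosed := by rfl
  isKnot := by rfl

end VirtualKnot

/-! Non-equivalence comes from Fox 3-colourings. With the rule that the three colours at a classical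
crossing add up to zero, and virtual crossings ignored, every local move preserves the number of
colourings: the layers outside the move are common to both words (`colorings_congr_prefix`), and the
move itself amounts to a small identity in `ZMod 3` or to an exchange of two sums
(`colorings_localMove`). `KD` has nine colourings, the unknot three.

The brackets are computed. Three parallel copies of `KD` have 72 classical crossings, too many to
list states. But when a diagram is read from bottom to top, the part already read matters only
through the way it pairs the open strands, so a linear combination of perfect matchings replaces the
list of states (`stateSum_eq`). After a power of `A` is split off, all weights are polynomials in `r
= A^(-2)`: a crossing is `1` or `r^2` times the vertical smoothing plus `r` times the horizontal
one, and a closed curve turns the factor `r` into `r * d = -(1 + r^2)`.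

The kernel works with integers instead of polynomials, at `r = base`. The coefficients are bounded a
priori (`bounded_evalProgram`) by less than `base`, so one integer equality forces the polynomial
identity (`eq_zero_of_eval_eq_zero`); `bracket_eq_of_check` then returns to the bracket. For `N = 3`
the two tangles are evaluated independently and then multiplied (`sum_evalProgram_of_avoids`,
`returns_prod`). -/

namespace VirtualKnot

/-! ### Fox colourings -/

/-- The colourings of the upper ends of a piece with colours in `ZMod 3`, for given colours of the
lower ends: a strand keeps its colour unless it passes under another one, and the three colours at
a classical crossing add up to zero. -/
def Piece.colors : Piece → List (ZMod 3) → Multiset (List (ZMod 3))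
  | .cup, [] => (Finset.univ : Finset (ZMod 3)).val.map fun x => [x, x]
  | .cap, [a, b] => if a = b then {[]} else 0
  | .cross .over, [a, b] => {[-(a + b), a]}
  | .cross .under, [a, b] => {[b, -(a + b)]}
  | .cross .virt, [a, b] => {[b, a]}
  | _, _ => 0

/-- The number of Fox `3`-colourings of a word for given colours of its lower ends. -/
def colorings : Word → List (ZMod 3) → ℕ
  | [], _ => 1
  | (p, i) :: w, s =>
    ((p.colors ((s.drop i).take p.inputs)).map fun o =>
      colorings w (s.take i ++ o ++ s.drop (i + p.inputs))).sum

theorem colorings_cons (p : Piece) (w : Word) (a b c : List (ZMod 3)) (h : b.length = p.inputs) :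
    colorings ((p, a.length) :: w) (a ++ b ++ c) =
      ((p.colors b).map fun o => colorings w (a ++ o ++ c)).sum := by
  simp [colorings, ← h, ← List.drop_drop]

theorem length_of_mem_colors {p : Piece} {b o : List (ZMod 3)} (h : o ∈ p.colors b) :
    o.length = p.outputs := by
  unfold Piece.colors at h
  split at h <;> try split at h
  all_goals simp_all [Piece.outputs]
  obtain ⟨x, rfl⟩ := h
  rfl

theorem Word.width_append (u v : Word) (n : ℕ) :
    (u ++ v).width n = (u.width n).bind v.width := by
  induction u generalizing n with
  | nil => rfl
  | cons l u ih =>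
    simp only [List.cons_append, Word.width]
    cases Layer.width l n <;> simp [ih]

theorem Layer.exists_of_width {p : Piece} {i n n' : ℕ} (h : Layer.width (p, i) n = some n')
    {s : List (ZMod 3)} (hs : s.length = n) :
    ∃ a b c, s = a ++ b ++ c ∧ a.length = i ∧ b.length = p.inputs ∧
      n' = a.length + p.outputs + c.length := by
  simp only [Layer.width] at h
  split at h
  · rename_i hi
    refine ⟨s.take i, (s.drop i).take p.inputs, s.drop (i + p.inputs), ?_, ?_, ?_, ?_⟩
    · simp [← List.drop_drop]
    · simp; omega
    · simp; omega
    · simp at h ⊢; omega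
  · simp at h

/-- Colourings can be counted by extending them upwards through the common layers `u`. The width
fixes the number of colours that reach `l` and `r`, so only lists of that length have to be
compared. -/
theorem colorings_congr_prefix {l r : Word} (u : Word) {n m : ℕ} (hu : u.width n = some m)
    (h : ∀ s : List (ZMod 3), s.length = m → colorings l s = colorings r s)
    (s : List (ZMod 3)) (hs : s.length = n) : colorings (u ++ l) s = colorings (u ++ r) s := by
  induction u generalizing n s with
  | nil => simp only [Word.width, Option.some.injEq] at hu; exact h s (hs.trans hu)
  | cons x u ih =>
    obtain ⟨p, i⟩ := x
    simp only [Word.width, Option.bind_eq_some_iff] at hu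
    obtain ⟨n', h1, h2⟩ := hu
    obtain ⟨a, b, c, rfl, rfl, hb, rfl⟩ := Layer.exists_of_width h1 hs
    rw [List.cons_append, List.cons_append, colorings_cons _ _ _ _ _ hb,
      colorings_cons _ _ _ _ _ hb]
    refine congrArg Multiset.sum (Multiset.map_congr rfl fun o ho => ih h2 _ ?_)
    simp [length_of_mem_colors ho]; omega

/-- The two pieces act on the disjoint blocks `b` and `e`, so both sides are double sums over
independent choices, taken in opposite orders. -/
theorem colorings_exchange (p q : Piece) (v : Word) (a b c e f : List (ZMod 3))
    (hb : b.length = p.inputs) (he : e.length = q.inputs) :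
    colorings ((p, a.length) :: (q, a.length + p.outputs + c.length) :: v)
        (a ++ b ++ (c ++ e ++ f)) =
      colorings ((q, a.length + p.inputs + c.length) :: (p, a.length) :: v)
        (a ++ b ++ (c ++ e ++ f)) := by
  rw [colorings_cons _ _ _ _ _ hb]
  have h1 : ∀ o ∈ p.colors b,
      colorings ((q, a.length + p.outputs + c.length) :: v) (a ++ o ++ (c ++ e ++ f)) =
        ((q.colors e).map fun o' => colorings v (a ++ o ++ (c ++ o' ++ f))).sum := by
    intro o ho
    have := colorings_cons q v (a ++ o ++ c) e f he
    simp only [List.length_append, length_of_mem_colors ho] at this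
    simpa [List.append_assoc] using this
  rw [Multiset.map_congr rfl h1]
  have h2 := colorings_cons q ((p, a.length) :: v) (a ++ b ++ c) e f he
  simp only [List.length_append, hb] at h2
  have h3 : ∀ o' ∈ q.colors e, colorings ((p, a.length) :: v) (a ++ b ++ c ++ o' ++ f) =
      ((p.colors b).map fun o => colorings v (a ++ o ++ (c ++ o' ++ f))).sum := by
    intro o' _
    have := colorings_cons p v a b (c ++ o' ++ f) hb
    simpa [List.append_assoc] using this
  rw [Multiset.map_congr rfl h3] at h2
  rw [show a ++ b ++ (c ++ e ++ f) = a ++ b ++ c ++ e ++ f by simp, h2]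
  exact Multiset.sum_map_sum_map _ _

theorem exists_eq_append {s : List (ZMod 3)} {i : ℕ} (h : i ≤ s.length) :
    ∃ a t, s = a ++ t ∧ a.length = i := ⟨s.take i, s.drop i, by simp, by simpa using h⟩

theorem width_cons_eq_some {l : Layer} {w : Word} {n k : ℕ} (h : Word.width (l :: w) n = some k) :
    l.2 + l.1.inputs ≤ n ∧ Word.width w (n - l.1.inputs + l.1.outputs) = some k := by
  simp only [Word.width, Layer.width] at h
  split at h
  · exact ⟨‹_›, by simpa using h⟩
  · simp at h

/-! ### Crossings as maps on pairs of colours, and invariance under the local moves -/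

/-- The colours of the upper ends of a crossing. -/
def Crossing.color : Crossing → ZMod 3 → ZMod 3 → ZMod 3 × ZMod 3
  | .over, a, b => (-(a + b), a)
  | .under, a, b => (b, -(a + b))
  | .virt, a, b => (b, a)

theorem colorings_cross (c : Crossing) (w : Word) (a t : List (ZMod 3)) (x y : ZMod 3) :
    colorings (cross c a.length :: w) (a ++ x :: y :: t) =
      colorings w (a ++ (c.color x y).1 :: (c.color x y).2 :: t) := by
  have := colorings_cons (.cross c) w a [x, y] t rfl
  simp only [List.append_assoc, List.cons_append, List.nil_append] at this
  rw [this]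
  cases c <;> simp [Piece.colors, Crossing.color]

theorem colorings_cross_succ (c : Crossing) (w : Word) (a t : List (ZMod 3)) (u x y : ZMod 3) :
    colorings (cross c (a.length + 1) :: w) (a ++ u :: x :: y :: t) =
      colorings w (a ++ u :: (c.color x y).1 :: (c.color x y).2 :: t) := by
  simpa using colorings_cross c w (a ++ [u]) t x y

theorem colorings_cup (w : Word) (a t : List (ZMod 3)) :
    colorings (cup a.length :: w) (a ++ t) = ∑ x : ZMod 3, colorings w (a ++ x :: x :: t) := by
  have := colorings_cons .cup w a [] t rfl
  simp only [List.append_assoc, List.nil_append] at this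
  rw [this]
  rfl

theorem colorings_cup_succ (w : Word) (a t : List (ZMod 3)) (u : ZMod 3) :
    colorings (cup (a.length + 1) :: w) (a ++ u :: t) =
      ∑ x : ZMod 3, colorings w (a ++ u :: x :: x :: t) := by
  simpa using colorings_cup w (a ++ [u]) t

theorem colorings_cap (w : Word) (a t : List (ZMod 3)) (x y : ZMod 3) :
    colorings (cap a.length :: w) (a ++ x :: y :: t) =
      if x = y then colorings w (a ++ t) else 0 := by
  have := colorings_cons .cap w a [x, y] t rfl
  simp only [List.append_assoc, List.cons_append, List.nil_append] at this
  rw [this]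
  simp only [Piece.colors]
  split <;> simp

theorem colorings_cap_succ (w : Word) (a t : List (ZMod 3)) (u x y : ZMod 3) :
    colorings (cap (a.length + 1) :: w) (a ++ u :: x :: y :: t) =
      if x = y then colorings w (a ++ u :: t) else 0 := by
  simpa using colorings_cap w (a ++ [u]) t x y

/-- For classical crossings this is the self-distributivity of the operation `2a - b = -(a + b)`. A
strand with only virtual crossings keeps its colour and does not affect the other two. The forbidden
triples are excluded by `h`. -/
theorem Crossing.color_third (c₁₂ c₁₃ c₂₃ : Crossing) (h : ThirdMoveAllowed c₁₂ c₁₃ c₂₃)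
    (x y z : ZMod 3) :
    let p := c₁₂.color x y
    let q := c₁₃.color p.2 z
    let p' := c₂₃.color p.1 q.1
    let r := c₂₃.color y z
    let s := c₁₃.color x r.1
    let r' := c₁₂.color s.2 r.2
    p'.1 = s.1 ∧ p'.2 = r'.1 ∧ q.2 = r'.2 := by
  cases c₁₂ <;> cases c₁₃ <;> cases c₂₃ <;>
    first
    | exact h.elim
    | (simp only [Crossing.color]; revert x y z; decide)

theorem Crossing.color_self (c : Crossing) (x : ZMod 3) : c.color x x = (x, x) := by
  cases c <;> revert x <;> decide

theorem Crossing.color_fst_eq_snd (c : Crossing) (x y : ZMod 3) :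
    (c.color x y).1 = (c.color x y).2 ↔ x = y := by
  cases c <;> revert x y <;> decide

theorem Crossing.color_switch (c : Crossing) (x y : ZMod 3) :
    c.switch.color (c.color x y).1 (c.color x y).2 = (x, y) := by
  cases c <;> revert x y <;> decide

theorem Crossing.color_slide_cap (c : Crossing) (x y z : ZMod 3) :
    (x = (c.color y z).1 ↔ (c.switch.color x y).2 = z) ∧
      (x = (c.color y z).1 → (c.color y z).2 = (c.switch.color x y).1) := by
  cases c <;> revert x y z <;> decide

/-- The minimum moves to the other side of the strand coloured `s`. If the bent arc passes under
that strand, its colour at the minimum changes, and the sum is reindexed by the involution `x ↦ -(x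
+ s)`; otherwise the sums agree term by term. -/
theorem Crossing.sum_color_slide_cup (c : Crossing) (F : ZMod 3 → ZMod 3 → ZMod 3 → ℕ)
    (s : ZMod 3) :
    ∑ x, F x (c.color x s).1 (c.color x s).2 =
      ∑ y, F (c.switch.color s y).1 (c.switch.color s y).2 y := by
  cases c
  · simp only [Crossing.color, Crossing.switch, add_comm s]
  · refine Fintype.sum_bijective (fun x => -(x + s)) ?_ _ _ fun x => ?_
    · exact Function.Involutive.bijective fun x => by ring
    · simp [Crossing.color, Crossing.switch]
  · rfl

/-- The widths supply the strands on which the move acts. Without them the counts can differ: a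
zigzag with no strand to straighten has no colourings, while the empty word imposes no condition. -/
theorem colorings_localMove {l r : Word} (h : LocalMove l r) (v : Word) {s : List (ZMod 3)}
    {k k' : ℕ} (hl : Word.width (l ++ v) s.length = some k)
    (hr : Word.width (r ++ v) s.length = some k') :
    colorings (l ++ v) s = colorings (r ++ v) s := by
  cases h with
  | exchange p q i k =>
    obtain ⟨h1, h2⟩ := width_cons_eq_some hr
    obtain ⟨h3, -⟩ := width_cons_eq_some hl
    simp only at h1 h3
    obtain ⟨a, s, rfl, rfl⟩ := exists_eq_append (s := s) (i := i) (by omega)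
    simp only [List.length_append] at h1
    obtain ⟨b, s, rfl, hb⟩ := exists_eq_append (s := s) (i := p.inputs) (by omega)
    simp only [List.length_append] at h1
    obtain ⟨c, s, rfl, rfl⟩ := exists_eq_append (s := s) (i := k) (by omega)
    simp only [List.length_append] at h1
    obtain ⟨e, s, rfl, he⟩ := exists_eq_append (s := s) (i := q.inputs) (by omega)
    simpa using colorings_exchange p q v a b c e s hb he
  | zigzag_left i =>
    obtain ⟨h1, h2⟩ := width_cons_eq_some hl
    obtain ⟨h3, -⟩ := width_cons_eq_some h2
    simp only [Piece.inputs, Piece.outputs] at h1 h3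
    obtain ⟨a, _ | ⟨x, t⟩, rfl, rfl⟩ := exists_eq_append (s := s) (i := i) (by omega)
    · simp at h3
    · simp [colorings_cup, colorings_cap_succ]
  | zigzag_right i =>
    obtain ⟨h1, h2⟩ := width_cons_eq_some hl
    simp only [Piece.inputs] at h1
    obtain ⟨a, _ | ⟨x, t⟩, rfl, rfl⟩ := exists_eq_append (s := s) (i := i) (by omega)
    · simp at h1
    · simp [colorings_cup_succ, colorings_cap]
  | slide_cup c i =>
    obtain ⟨h1, -⟩ := width_cons_eq_some hr
    simp only [Piece.inputs] at h1
    obtain ⟨a, _ | ⟨x, t⟩, rfl, rfl⟩ := exists_eq_append (s := s) (i := i) (by omega)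
    · simp at h1
    · simp only [List.cons_append, List.nil_append, colorings_cup, colorings_cup_succ,
        colorings_cross, colorings_cross_succ]
      exact c.sum_color_slide_cup (fun x y z => colorings v (a ++ x :: y :: z :: t)) x
  | slide_cap c i =>
    obtain ⟨h1, -⟩ := width_cons_eq_some hl
    simp only [Piece.inputs] at h1
    obtain ⟨a, _ | ⟨x, _ | ⟨y, _ | ⟨z, t⟩⟩⟩, rfl, rfl⟩ :=
      exists_eq_append (s := s) (i := i) (by omega)
    · simp at h1; omega
    · simp at h1
    · simp at h1
    · simp only [List.cons_append, List.nil_append, colorings_cap, colorings_cap_succ,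
        colorings_cross, colorings_cross_succ]
      obtain ⟨e1, e2⟩ := c.color_slide_cap x y z
      by_cases hx : x = (c.color y z).1
      · rw [if_pos hx, if_pos (e1.1 hx), e2 hx]
      · rw [if_neg hx, if_neg (mt e1.2 hx)]
  | first_cup c i =>
    obtain ⟨h1, -⟩ := width_cons_eq_some hl
    simp only [Piece.inputs] at h1
    obtain ⟨a, t, rfl, rfl⟩ := exists_eq_append (s := s) (i := i) (by omega)
    simp only [List.cons_append, List.nil_append, colorings_cup, colorings_cross]
    simp only [Crossing.color_self]
  | first_cap c i =>
    obtain ⟨h1, -⟩ := width_cons_eq_some hl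
    simp only [Piece.inputs] at h1
    obtain ⟨a, _ | ⟨x, _ | ⟨y, t⟩⟩, rfl, rfl⟩ := exists_eq_append (s := s) (i := i) (by omega)
    · simp at h1
    · simp at h1
    · simp only [List.cons_append, List.nil_append, colorings_cap, colorings_cross]
      simp only [Crossing.color_fst_eq_snd]
  | second c i =>
    obtain ⟨h1, -⟩ := width_cons_eq_some hl
    simp only [Piece.inputs] at h1
    obtain ⟨a, _ | ⟨x, _ | ⟨y, t⟩⟩, rfl, rfl⟩ := exists_eq_append (s := s) (i := i) (by omega)
    · simp at h1
    · simp at h1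
    · simp only [List.cons_append, List.nil_append, colorings_cross]
      simp only [Crossing.color_switch]
  | third c₁₂ c₁₃ c₂₃ h i =>
    obtain ⟨h1, -⟩ := width_cons_eq_some hr
    simp only [Piece.inputs] at h1
    obtain ⟨a, _ | ⟨x, _ | ⟨y, _ | ⟨z, t⟩⟩⟩, rfl, rfl⟩ :=
      exists_eq_append (s := s) (i := i) (by omega)
    · simp at h1; omega
    · simp at h1
    · simp at h1
    · obtain ⟨e1, e2, e3⟩ := Crossing.color_third c₁₂ c₁₃ c₂₃ h x y z
      simp only [List.cons_append, List.nil_append, colorings_cross, colorings_cross_succ, e1, e2,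
        e3]

theorem colorings_step {K K' : VirtualKnotDiagram} (h : Step K K') :
    colorings K.word [] = colorings K'.word [] := by
  obtain ⟨u, l, r, v, hm, hK, hK'⟩ := h
  have h1 := K.isClosed
  have h2 := K'.isClosed
  rw [hK, Word.IsClosed, List.append_assoc, Word.width_append, Option.bind_eq_some_iff] at h1
  rw [hK', Word.IsClosed, List.append_assoc, Word.width_append, Option.bind_eq_some_iff] at h2
  obtain ⟨n, hn, h1⟩ := h1
  obtain ⟨n', hn', h2⟩ := h2
  obtain rfl : n = n' := by simpa [hn] using hn'
  rw [hK, hK', List.append_assoc, List.append_assoc]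
  refine colorings_congr_prefix u hn (fun s hs => ?_) [] rfl
  subst hs
  exact colorings_localMove hm v h1 h2

theorem VirtuallyEquivalent.colorings_eq {K K' : VirtualKnotDiagram}
    (h : VirtuallyEquivalent K K') : colorings K.word [] = colorings K'.word [] := by
  induction h with
  | rel _ _ h => exact colorings_step h
  | refl => rfl
  | symm _ _ _ ih => exact ih.symm
  | trans _ _ _ _ _ ih ih' => exact ih.trans ih'

theorem not_virtuallyEquivalent_KD_unknot : ¬ VirtuallyEquivalent KD unknot := fun h => by
  -- Both diagrams have the three constant colourings; `KD` has six others.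
  have h1 : colorings KD.word [] = 9 := by decide +kernel
  have h2 : colorings unknot.word [] = 3 := by decide +kernel
  have := h.colorings_eq
  omega

/-! ### Perfect matchings coded by natural numbers

A perfect matching of a set of slots (numbers below `32`) is coded by the number whose digit at a
slot, in base `32`, is the partner of the slot. -/

/-- The digit at the place `p`. -/
def digit (m p : ℕ) : ℕ := Nat.mod (Nat.shiftRight m (Nat.mul 5 p)) 32

/-- Change the digit at the place `p` by `x`. -/
def flip (m p x : ℕ) : ℕ := Nat.xor m (Nat.shiftLeft x (Nat.mul 5 p))

/-- Match the free slots `p` and `q`. -/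
def pair (m p q : ℕ) : ℕ := flip (flip m p q) q p

/-- Remove the slots `p` and `q` and match their partners `x` and `y`. -/
def joinAt (m p q x y : ℕ) : ℕ :=
  flip (flip (flip (flip m p x) q y) x (Nat.xor p y)) y (Nat.xor q x)

/-- Remove the slots `p` and `q` and match their partners. -/
def join (m p q : ℕ) : ℕ := joinAt m p q (digit m p) (digit m q)

theorem digit_lt (m p : ℕ) : digit m p < 32 := Nat.mod_lt _ (by norm_num)

theorem flip_eq (m p x : ℕ) : flip m p x = m ^^^ (x <<< (5 * p)) := rfl

theorem testBit_digit (m p i : ℕ) : (digit m p).testBit i = (decide (i < 5) && m.testBit (5 * p + i)) := by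
  have : digit m p = (m >>> (5 * p)) % 2 ^ 5 := rfl
  rw [this, Nat.testBit_mod_two_pow, Nat.testBit_shiftRight]

theorem digit_xor (m n p : ℕ) : digit (m ^^^ n) p = digit m p ^^^ digit n p := by
  refine Nat.eq_of_testBit_eq fun i => ?_
  simp only [testBit_digit, Nat.testBit_xor]
  cases decide (i < 5) <;> simp

theorem digit_shiftLeft {x : ℕ} (hx : x < 32) (p z : ℕ) :
    digit (x <<< (5 * p)) z = if z = p then x else 0 := by
  refine Nat.eq_of_testBit_eq fun i => ?_
  have h (j : ℕ) (hj : 5 ≤ j) : x.testBit j = false :=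
    Nat.testBit_lt_two_pow (hx.trans_le (by
      calc 32 = 2 ^ 5 := by norm_num
        _ ≤ 2 ^ j := Nat.pow_le_pow_right (by norm_num) hj))
  rw [testBit_digit, Nat.testBit_shiftLeft]
  by_cases hi : i < 5
  · rcases lt_trichotomy z p with hz | rfl | hz
    · simp [show ¬ 5 * z + i ≥ 5 * p by omega, hz.ne]
    · simp [hi]
    · simp [hz.ne', h (5 * z + i - 5 * p) (by omega)]
  · split
    · simp [hi, h i (by omega)]
    · simp [hi]

theorem digit_flip {x : ℕ} (hx : x < 32) (m p z : ℕ) :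
    digit (flip m p x) z = if z = p then digit m z ^^^ x else digit m z := by
  rw [flip_eq, digit_xor, digit_shiftLeft hx]
  split <;> simp

theorem xor_lt {x y : ℕ} (hx : x < 32) (hy : y < 32) : x ^^^ y < 32 :=
  Nat.xor_lt_two_pow (n := 5) hx hy

theorem flip_xor (m n p x : ℕ) : flip (m ^^^ n) p x = m ^^^ flip n p x := by
  simp only [flip_eq, Nat.xor_assoc]

theorem pair_xor (m n p q : ℕ) : pair (m ^^^ n) p q = m ^^^ pair n p q := by
  simp only [pair, flip_xor]

/-- Digits are changed by XOR rather than overwritten so that matchings of disjoint sets of slots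
can be superposed and updated separately. -/
theorem joinAt_xor (m n p q x y : ℕ) : joinAt (m ^^^ n) p q x y = m ^^^ joinAt n p q x y := by
  simp only [joinAt, flip_xor]

theorem digit_pair {m p q : ℕ} (hp : p < 32) (hq : q < 32) (hpq : p ≠ q) (hmp : digit m p = 0)
    (hmq : digit m q = 0) (z : ℕ) :
    digit (pair m p q) z = if z = p then q else if z = q then p else digit m z := by
  rw [pair, digit_flip hp, digit_flip hq]
  split_ifs <;> simp_all

/-- If `p` and `q` are partners of each other, the last two changes in `joinAt` are by zero, so
closing a curve needs no separate definition. -/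
theorem digit_join {m p q : ℕ} (hp : p < 32) (hq : q < 32) (hpq : p ≠ q)
    (hp' : digit m (digit m p) = p) (hq' : digit m (digit m q) = q)
    (hp1 : digit m p ≠ p) (hq1 : digit m q ≠ q) (z : ℕ) :
    digit (join m p q) z = if z = p then 0 else if z = q then 0 else
      if z = digit m p then digit m q else if z = digit m q then digit m p else digit m z := by
  have hx := digit_lt m p
  have hy := digit_lt m q
  have hxy : digit m p ≠ digit m q := fun h => hpq (by rw [← hp', h, hq'])
  have e (a b : ℕ) : Nat.xor a b = a ^^^ b := rfl
  rw [join, joinAt, e, e, digit_flip (xor_lt hq hx), digit_flip (xor_lt hp hy), digit_flip hy,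
    digit_flip hx]
  generalize hX : digit m p = x at *
  generalize hY : digit m q = y at *
  by_cases h1 : x = q
  · subst h1
    obtain rfl : y = p := by rw [← hY, hp']
    by_cases h2 : z = y
    · subst h2; simp [hpq, hX]
    · by_cases h3 : z = x
      · subst h3; simp [h2, hY]
      · simp [h2, h3]
  · have h2 : y ≠ p := fun h => h1 (by rw [← hX, ← h, hq'])
    by_cases hz1 : z = p
    · subst hz1; simp [hpq, hp1.symm, h2.symm, hX]
    by_cases hz2 : z = q
    · subst hz2; simp [hz1, hq1.symm, Ne.symm h1, hY]
    by_cases hz3 : z = x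
    · subst hz3; simp [hz1, hz2, hxy, hp']
    by_cases hz4 : z = y
    · subst hz4; simp [hz1, hz2, hxy.symm, hq']
    simp [hz1, hz2, hz3, hz4]

/-! ### Programs -/

/-- An instruction of a program: new matched slots, removal of two slots, or a classical crossing
at two slots, which is an `over` crossing if the first argument is `true`. -/
inductive Instr
  | cup (p q : ℕ)
  | cap (p q : ℕ)
  | cross (b : Bool) (p q : ℕ)

/-- The program of a word; `s` lists the slots of the strands, and `f` the free slots. -/
def compile : Word → List ℕ → List ℕ → Option (List Instr)
  | [], s, _ => match s with
    | [] => some []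
    | _ :: _ => none
  | (.cup, i) :: w, s, f =>
    match f with
    | p :: q :: f => (compile w (s.take i ++ p :: q :: s.drop i) f).map (Instr.cup p q :: ·)
    | _ => none
  | (.cap, i) :: w, s, f =>
    match s.drop i with
    | p :: q :: t => (compile w (s.take i ++ t) (p :: q :: f)).map (Instr.cap p q :: ·)
    | _ => none
  | (.cross c, i) :: w, s, f =>
    match s.drop i with
    | p :: q :: t =>
      match c with
      | .virt => compile w (s.take i ++ q :: p :: t) f
      | .over => (compile w s f).map (Instr.cross true p q :: ·)
      | .under => (compile w s f).map (Instr.cross false p q :: ·)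
    | _ => none

section Eval

variable {R : Type*} [CommRing R]

/-- The weight of a local maximum between slots with partners `x` and `y`. -/
def capWeight (r : R) (x q : ℕ) : R := if x = q then -(1 + r ^ 2) else r

/-- The state sum of a program, with `F` applied to the final matchings. -/
def evalProgram (r : R) (F : ℕ → R) : List Instr → ℕ → R
  | [], m => F m
  | .cup p q :: l, m => evalProgram r F l (pair m p q)
  | .cap p q :: l, m => capWeight r (digit m p) q * evalProgram r F l (join m p q)
  | .cross b p q :: l, m => (if b then 1 else r ^ 2) * evalProgram r F l m +
      capWeight r (digit m p) q * evalProgram r F l (pair (join m p q) p q)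

theorem evalProgram_append (r : R) (F : ℕ → R) (l l' : List Instr) (m : ℕ) :
    evalProgram r F (l ++ l') m = evalProgram r (evalProgram r F l') l m := by
  induction l generalizing m with
  | nil => rfl
  | cons o l ih => cases o <;> simp [evalProgram, ih]

/-- This links the generic value in `ℤ[X]` with its two specialisations: the integer at `base`,
found by the kernel, and the Laurent polynomial at `A^(-2)`. -/
theorem map_evalProgram {S : Type*} [CommRing S] (φ : R →+* S) (r : R) (F : ℕ → R)
    (l : List Instr) (m : ℕ) :
    φ (evalProgram r F l m) = evalProgram (φ r) (φ ∘ F) l m := by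
  have h (x q : ℕ) : φ (capWeight r x q) = capWeight (φ r) x q := by
    unfold capWeight; split <;> simp
  induction l generalizing m with
  | nil => rfl
  | cons o l ih =>
    rcases o with ⟨p, q⟩ | ⟨p, q⟩ | ⟨_ | _, p, q⟩ <;> simp [evalProgram, ih, h]

/-- The digits at the slots of an instruction vanish. -/
def Instr.avoids (m : ℕ) : Instr → Bool
  | .cup _ _ => true
  | .cap p q => Nat.beq (digit m p) 0 && Nat.beq (digit m q) 0
  | .cross _ p q => Nat.beq (digit m p) 0 && Nat.beq (digit m q) 0

/-- Since `m` is zero at the slots read by the program, all weights and partners come from `k`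
alone. A `cup` reads no digit and needs no condition. -/
theorem evalProgram_xor (r : R) (F : ℕ → R) (l : List Instr) (m k : ℕ)
    (h : ∀ o ∈ l, Instr.avoids m o = true) :
    evalProgram r F l (m ^^^ k) = evalProgram r (fun k => F (m ^^^ k)) l k := by
  induction l generalizing k with
  | nil => rfl
  | cons o l ih =>
    have hl : ∀ k, _ := fun k => ih k fun o ho => h o (List.mem_cons_of_mem _ ho)
    have ho := h o List.mem_cons_self
    rcases o with ⟨p, q⟩ | ⟨p, q⟩ | ⟨b, p, q⟩
    · simp only [evalProgram, pair_xor, hl]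
    all_goals
      simp only [Instr.avoids, Bool.and_eq_true, Nat.beq_eq] at ho
      simp only [evalProgram, join, digit_xor, ho.1, ho.2, Nat.zero_xor, joinAt_xor, pair_xor, hl]

end Eval

/-! ### Evaluation of programs in the kernel

Linear combinations of matchings are stored in binary trees.  All functions are in
continuation-passing style, so that the kernel evaluates the intermediate results only once. -/

/-- The value of the variable. -/
def base : ℕ := Nat.pow 3 100

/-- Evaluate `n` before it is passed on to `f`. -/
noncomputable def force {α : Type} (n : ℕ) (f : ℕ → α) : α :=
  Nat.rec (f 0) (fun m _ => f (Nat.succ m)) n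

theorem force_eq {α : Type} (n : ℕ) (f : ℕ → α) : force n f = f n := by cases n <;> rfl

/-- `x` if `b` is true and `y` otherwise. -/
noncomputable def branch {α : Type} (b : Bool) (x y : α) : α := Bool.rec y x b

theorem branch_eq {α : Type} (b : Bool) (x y : α) : branch b x y = if b then x else y := by
  cases b <;> rfl

/-- A binary tree; a node holds a sorting key `h`, a matching `k` and its coefficient `p - n`. -/
inductive MatchTree
  | leaf
  | node (h k p n : ℕ) (l r : MatchTree)

namespace MatchTree

/-- The linear combination of the values of a function on the matchings of a tree. -/
def sum (F : ℕ → ℤ) : MatchTree → ℤ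
  | leaf => 0
  | node _ k p n l r => ((p : ℤ) - n) * F k + l.sum F + r.sum F

/-- `f` passes a tree with the sums `S` to its continuation. -/
def Returns (f : (MatchTree → Bool) → Bool) (S : (ℕ → ℤ) → ℤ) : Prop :=
  ∃ t : MatchTree, (∀ c, f c = c t) ∧ ∀ F, t.sum F = S F

/-- Insert a term into a tree. -/
noncomputable def ins (h k p n : ℕ) (t : MatchTree) : (MatchTree → Bool) → Bool :=
  MatchTree.rec (fun c => c (node h k p n leaf leaf))
    (fun h' k' p' n' l r il ir c =>
      branch (Nat.beq h h')
        (branch (Nat.beq k k')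
          (force (Nat.add p p') fun p => force (Nat.add n n') fun n => c (node h k p n l r))
          (il fun l => c (node h' k' p' n' l r)))
        (branch (Nat.ble h h')
          (il fun l => c (node h' k' p' n' l r))
          (ir fun r => c (node h' k' p' n' l r)))) t

/-- The sum is right wherever the term lands, since coefficients merge only for equal matchings.
Hence no ordering invariant of the tree is needed. -/
theorem returns_ins (h k p n : ℕ) (t : MatchTree) :
    Returns (t.ins h k p n) fun F => t.sum F + ((p : ℤ) - n) * F k := by
  induction t with
  | leaf => exact ⟨node h k p n leaf leaf, fun c => rfl, fun F => by simp [sum]⟩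
  | node h' k' p' n' l r il ir =>
    obtain ⟨l', hl, hl'⟩ := il
    obtain ⟨r', hr, hr'⟩ := ir
    have key (c : MatchTree → Bool) : ins h k p n (node h' k' p' n' l r) c =
      branch (Nat.beq h h')
        (branch (Nat.beq k k')
          (force (Nat.add p p') fun p => force (Nat.add n n') fun n => c (node h k p n l r))
          (ins h k p n l fun l => c (node h' k' p' n' l r)))
        (branch (Nat.ble h h')
          (ins h k p n l fun l => c (node h' k' p' n' l r))
          (ins h k p n r fun r => c (node h' k' p' n' l r))) := rfl
    simp only [branch_eq, force_eq, hl, hr] at key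
    have h1 : Returns (fun c => c (node h' k' p' n' l' r)) fun F =>
        sum F (node h' k' p' n' l r) + ((p : ℤ) - n) * F k :=
      ⟨_, fun _ => rfl, fun F => by simp only [sum, hl']; ring⟩
    have h2 : Returns (fun c => c (node h' k' p' n' l r')) fun F =>
        sum F (node h' k' p' n' l r) + ((p : ℤ) - n) * F k :=
      ⟨_, fun _ => rfl, fun F => by simp only [sum, hr']; ring⟩
    by_cases e1 : Nat.beq h h' = true
    · simp only [e1, if_true] at key
      by_cases e2 : Nat.beq k k' = true
      · simp only [e2, if_true] at key
        refine ⟨_, key, fun F => ?_⟩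
        obtain rfl := Nat.eq_of_beq_eq_true e2
        simp only [sum, Nat.add_eq, Nat.cast_add]
        ring
      · simp only [e2] at key
        obtain ⟨t, ht, ht'⟩ := h1
        exact ⟨t, fun c => (key c).trans (ht c), ht'⟩
    · simp only [e1] at key
      by_cases e2 : Nat.ble h h' = true
      · simp only [e2, if_true] at key
        obtain ⟨t, ht, ht'⟩ := h1
        exact ⟨t, fun c => (key c).trans (ht c), ht'⟩
      · simp only [e2] at key
        obtain ⟨t, ht, ht'⟩ := h2
        exact ⟨t, fun c => (key c).trans (ht c), ht'⟩

/-- Insert a term into a tree, sorted by a pseudorandom function of the matching. -/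
noncomputable def insert (k p n : ℕ) (t : MatchTree) (c : MatchTree → Bool) : Bool :=
  force (Nat.mod (Nat.mul k 982451653) 1073741789) fun h => t.ins h k p n c

theorem returns_insert (k p n : ℕ) (t : MatchTree) :
    Returns (t.insert k p n) fun F => t.sum F + ((p : ℤ) - n) * F k := by
  obtain ⟨t', h, h'⟩ := returns_ins (Nat.mod (Nat.mul k 982451653) 1073741789) k p n t
  exact ⟨t', fun c => by rw [insert, force_eq, h], h'⟩

/-- Apply `f` successively to the terms of a tree. -/
noncomputable def fold (f : ℕ → ℕ → ℕ → MatchTree → (MatchTree → Bool) → Bool) (t : MatchTree) :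
    MatchTree → (MatchTree → Bool) → Bool :=
  MatchTree.rec (fun a c => c a)
    (fun _ k p n _ _ il ir a c => il a fun a => f k p n a fun a => ir a c) t

/-- `G` is the transpose of the map on matchings carried out by `f`: pairing the image with `F` is
pairing the original with `G F`. -/
theorem returns_fold {f : ℕ → ℕ → ℕ → MatchTree → (MatchTree → Bool) → Bool} {G : (ℕ → ℤ) → ℕ → ℤ}
    (hf : ∀ k p n a, Returns (f k p n a) fun F => a.sum F + ((p : ℤ) - n) * G F k) (t a : MatchTree) :
    Returns (t.fold f a) fun F => a.sum F + t.sum (G F) := by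
  induction t generalizing a with
  | leaf => exact ⟨a, fun c => rfl, fun F => by simp [sum]⟩
  | node h k p n l r il ir =>
    obtain ⟨a1, h1, h1'⟩ := il a
    obtain ⟨a2, h2, h2'⟩ := hf k p n a1
    obtain ⟨a3, h3, h3'⟩ := ir a2
    refine ⟨a3, fun c => ?_, fun F => ?_⟩
    · have : fold f (node h k p n l r) a c =
        l.fold f a fun a => f k p n a fun a => r.fold f a c := rfl
      rw [this, h1, h2, h3]
    · simp only [h3', h2', h1', sum]; ring

/-- Multiply a linear combination by the square of the variable. -/
noncomputable def scale (t : MatchTree) : (MatchTree → Bool) → Bool :=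
  MatchTree.rec (fun c => c leaf)
    (fun h k p n _ _ il ir c => il fun l => ir fun r =>
      force (Nat.mul (Nat.mul p base) base) fun p =>
        force (Nat.mul (Nat.mul n base) base) fun n => c (node h k p n l r)) t

theorem returns_scale (t : MatchTree) : Returns t.scale fun F => (base : ℤ) ^ 2 * t.sum F := by
  induction t with
  | leaf => exact ⟨leaf, fun c => rfl, fun F => by simp [sum]⟩
  | node h k p n l r il ir =>
    obtain ⟨l', h1, h1'⟩ := il
    obtain ⟨r', h2, h2'⟩ := ir
    refine ⟨node h k (p * base * base) (n * base * base) l' r', fun c => ?_, fun F => ?_⟩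
    · have : scale (node h k p n l r) c = l.scale fun l => r.scale fun r =>
        force (Nat.mul (Nat.mul p base) base) fun p =>
          force (Nat.mul (Nat.mul n base) base) fun n => c (node h k p n l r) := rfl
      rw [this, h1, h2, force_eq, force_eq]
      rfl
    · simp only [sum, h1', h2']
      push_cast
      ring

end MatchTree

open MatchTree

/-- Apply a local maximum at `P` and `Q` to a term. -/
noncomputable def applyCap (P Q k p n : ℕ) (f : ℕ → ℕ → ℕ → Bool) : Bool :=
  force (digit k P) fun x => force (digit k Q) fun y => force (joinAt k P Q x y) fun k =>
    branch (Nat.beq x Q)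
      (force (Nat.add n (Nat.mul (Nat.mul n base) base)) fun n' =>
        force (Nat.add p (Nat.mul (Nat.mul p base) base)) fun p' => f k n' p')
      (force (Nat.mul p base) fun p => force (Nat.mul n base) fun n => f k p n)

theorem exists_applyCap (P Q k p n : ℕ) : ∃ p' n' : ℕ,
    (∀ f, applyCap P Q k p n f = f (join k P Q) p' n') ∧
      (p' : ℤ) - n' = ((p : ℤ) - n) * capWeight (base : ℤ) (digit k P) Q := by
  simp only [applyCap, force_eq, branch_eq]
  by_cases h : digit k P = Q
  -- A closed curve has the negative weight `-(1 + base ^ 2)`; exchanging the two natural parts of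
  -- the coefficient realises the sign.
  · refine ⟨_, _, fun f => if_pos (by simp [h]), ?_⟩
    simp only [capWeight, h, if_true, Nat.add_eq, Nat.mul_eq]
    push_cast
    ring
  · refine ⟨_, _, fun f => if_neg (by simpa using h), ?_⟩
    simp only [capWeight, h, if_false, Nat.mul_eq]
    push_cast
    ring

/-- Apply an instruction to a linear combination. -/
noncomputable def Instr.act (o : Instr) (t : MatchTree) (c : MatchTree → Bool) : Bool :=
  Instr.rec
    (fun P Q => t.fold (fun k p n a c => force (pair k P Q) fun k => a.insert k p n c) leaf c)
    (fun P Q => t.fold (fun k p n a c => applyCap P Q k p n fun k p n => a.insert k p n c) leaf c)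
    (fun b P Q => branch b (fun c : MatchTree → Bool => c t) t.scale fun s =>
      t.fold (fun k p n a c => applyCap P Q k p n fun k p n =>
        force (pair k P Q) fun k => a.insert k p n c) s c) o

theorem returns_act (o : Instr) (t : MatchTree) :
    Returns (o.act t) fun F => t.sum (evalProgram (base : ℤ) F [o]) := by
  rcases o with ⟨P, Q⟩ | ⟨P, Q⟩ | ⟨b, P, Q⟩
  · obtain ⟨t', h, h'⟩ := returns_fold
      (f := fun k p n a c => force (pair k P Q) fun k => a.insert k p n c)
      (G := fun F => evalProgram (base : ℤ) F [.cup P Q])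
      (fun k p n a => by
        obtain ⟨t', h, h'⟩ := returns_insert (pair k P Q) p n a
        exact ⟨t', fun c => by simp only [force_eq, h], fun F => by rw [h']; rfl⟩) t leaf
    exact ⟨t', h, fun F => by simp only [h', sum, zero_add]⟩
  · obtain ⟨t', h, h'⟩ := returns_fold
      (f := fun k p n a c => applyCap P Q k p n fun k p n => a.insert k p n c)
      (G := fun F => evalProgram (base : ℤ) F [.cap P Q])
      (fun k p n a => by
        obtain ⟨p', n', h1, h2⟩ := exists_applyCap P Q k p n
        obtain ⟨t', h, h'⟩ := returns_insert (join k P Q) p' n' a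
        exact ⟨t', fun c => by simp only [h1, h],
          fun F => by simp only [h', h2, evalProgram]; ring⟩) t leaf
    exact ⟨t', h, fun F => by simp only [h', sum, zero_add]⟩
  -- The horizontal smoothings are added to an accumulator `s` that already holds the vertical ones,
  -- scaled by `base ^ 2` for an under-crossing.
  · have key (s : MatchTree) := returns_fold
      (f := fun k p n a c => applyCap P Q k p n fun k p n =>
        force (pair k P Q) fun k => a.insert k p n c)
      (G := fun F k => capWeight (base : ℤ) (digit k P) Q * F (pair (join k P Q) P Q))
      (fun k p n a => by
        obtain ⟨p', n', h1, h2⟩ := exists_applyCap P Q k p n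
        obtain ⟨t', h, h'⟩ := returns_insert (pair (join k P Q) P Q) p' n' a
        exact ⟨t', fun c => by simp only [h1, force_eq, h],
          fun F => by simp only [h', h2]; ring⟩) t s
    have hev (F : ℕ → ℤ) (k : ℕ) : evalProgram (base : ℤ) F [.cross b P Q] k =
        (if b then 1 else (base : ℤ) ^ 2) * F k +
          capWeight (base : ℤ) (digit k P) Q * F (pair (join k P Q) P Q) := rfl
    have hsum (F : ℕ → ℤ) (t : MatchTree) :
        t.sum (evalProgram (base : ℤ) F [.cross b P Q]) = (if b then 1 else (base : ℤ) ^ 2) *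
          t.sum F + t.sum fun k =>
            capWeight (base : ℤ) (digit k P) Q * F (pair (join k P Q) P Q) := by
      induction t with
      | leaf => simp [sum]
      | node h k p n l r il ir => simp only [sum, il, ir, hev]; ring
    cases b
    · obtain ⟨s, hs, hs'⟩ := returns_scale t
      obtain ⟨t', h, h'⟩ := key s
      exact ⟨t', fun c => (hs _).trans (h c), fun F => by simp [h', hs', hsum]⟩
    · obtain ⟨t', h, h'⟩ := key t
      exact ⟨t', h, fun F => by simp [h', hsum]⟩

/-- Apply a program to a linear combination. -/
noncomputable def run (l : List Instr) : MatchTree → (MatchTree → Bool) → Bool :=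
  List.rec (fun t c => c t) (fun o _ ih t c => o.act t fun t => ih t c) l

theorem returns_run (l : List Instr) (t : MatchTree) :
    Returns (run l t) fun F => t.sum (evalProgram (base : ℤ) F l) := by
  induction l generalizing t with
  | nil => exact ⟨t, fun c => rfl, fun F => rfl⟩
  | cons o l ih =>
    obtain ⟨t1, h1, h1'⟩ := returns_act o t
    obtain ⟨t2, h2, h2'⟩ := ih t1
    refine ⟨t2, fun c => ?_, fun F => ?_⟩
    · have : run (o :: l) t c = o.act t fun t => run l t c := rfl
      rw [this, h1, h2]
    · simp only [h2', h1']
      exact congrArg (fun G => t.sum G)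
        (funext fun m => (evalProgram_append _ F [o] l m).symm)

/-! ### Independent evaluation of two blocks of a program -/

namespace MatchTree

/-- The product of two linear combinations of matchings of disjoint sets of slots. -/
noncomputable def prod (t t' : MatchTree) : (MatchTree → Bool) → Bool :=
  t.fold (fun k p n a c => t'.fold (fun k' p' n' a c => force (Nat.xor k k') fun k =>
    force (Nat.add (Nat.mul p p') (Nat.mul n n')) fun p'' =>
      force (Nat.add (Nat.mul p n') (Nat.mul n p')) fun n'' => a.insert k p'' n'' c) a c) leaf

theorem sum_mul_left (x : ℤ) (F : ℕ → ℤ) (t : MatchTree) : t.sum (fun k => x * F k) = x * t.sum F := by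
  induction t with
  | leaf => simp [sum]
  | node h k p n l r il ir => simp only [sum, il, ir]; ring

/-- For disjoint sets of slots, XOR of the codes is the union of the matchings. -/
theorem returns_prod (t t' : MatchTree) :
    Returns (t.prod t') fun F => t.sum fun k => t'.sum fun k' => F (k ^^^ k') := by
  obtain ⟨s, h, h'⟩ := returns_fold
    (f := fun k p n a c => t'.fold (fun k' p' n' a c => force (Nat.xor k k') fun k =>
      force (Nat.add (Nat.mul p p') (Nat.mul n n')) fun p'' =>
        force (Nat.add (Nat.mul p n') (Nat.mul n p')) fun n'' => a.insert k p'' n'' c) a c)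
    (G := fun F k => t'.sum fun k' => F (k ^^^ k')) (fun k p n a => by
      obtain ⟨s, h, h'⟩ := returns_fold
        (f := fun k' p' n' a c => force (Nat.xor k k') fun k =>
          force (Nat.add (Nat.mul p p') (Nat.mul n n')) fun p'' =>
            force (Nat.add (Nat.mul p n') (Nat.mul n p')) fun n'' => a.insert k p'' n'' c)
        (G := fun F k' => ((p : ℤ) - n) * F (k ^^^ k')) (fun k' p' n' a => by
          obtain ⟨s, h, h'⟩ := returns_insert (Nat.xor k k') (Nat.add (Nat.mul p p') (Nat.mul n n'))
            (Nat.add (Nat.mul p n') (Nat.mul n p')) a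
          refine ⟨s, fun c => by simp only [force_eq, h], fun F => ?_⟩
          simp only [h', Nat.add_eq, Nat.mul_eq]
          rw [show Nat.xor k k' = k ^^^ k' from rfl]
          push_cast
          ring) t' a
      exact ⟨s, h, fun F => by simp only [h', sum_mul_left]⟩) t leaf
  exact ⟨s, h, fun F => by simp only [h', sum, zero_add]⟩

/-- The slots of a program are not in use in the matchings of a tree. -/
noncomputable def avoids (l : List Instr) (t : MatchTree) : Bool :=
  MatchTree.rec true (fun _ k _ _ _ _ il ir => l.all (Instr.avoids k) && (il && ir)) t

/-- A block that does not touch the matchings of `t` can be run once, from the empty matching,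
instead of once for each of them. -/
theorem sum_evalProgram_of_avoids {l : List Instr} {t : MatchTree} (h : t.avoids l = true)
    (F : ℕ → ℤ) : t.sum (evalProgram (base : ℤ) F l) =
      t.sum fun m => evalProgram (base : ℤ) (fun k => F (m ^^^ k)) l 0 := by
  induction t with
  | leaf => rfl
  | node h' k p n a b ia ib =>
    have : avoids l (node h' k p n a b) =
      (l.all (Instr.avoids k) && (a.avoids l && b.avoids l)) := rfl
    rw [this, Bool.and_eq_true, Bool.and_eq_true, List.all_eq_true] at h
    have e := evalProgram_xor (base : ℤ) F l k 0 h.1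
    rw [Nat.xor_zero] at e
    simp only [sum, ia h.2.1, ib h.2.2, e]

end MatchTree

/-- Check that the state sum of a word is `v`.  The instructions are divided into three blocks, of
which the second one has length `b` and does not interact with the `a` instructions of the first
one. -/
noncomputable def check (w : Word) (f : List ℕ) (a b : ℕ) (v : ℤ) : Bool :=
  match compile w [] f with
  | none => false
  | some l =>
    run (l.take a) (node 0 0 1 0 leaf leaf) fun t =>
      branch (t.avoids ((l.drop a).take b))
        (run ((l.drop a).take b) (node 0 0 1 0 leaf leaf) fun t' =>
          t.prod t' fun t => run ((l.drop a).drop b) t fun t => decide (t.sum (fun _ => 1) = v))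
        false

theorem evalProgram_of_check {w : Word} {f : List ℕ} {a b : ℕ} {v : ℤ}
    (h : check w f a b v = true) :
    ∃ l, compile w [] f = some l ∧ evalProgram (base : ℤ) (fun _ => 1) l 0 = v := by
  unfold check at h
  split at h
  · simp at h
  · rename_i l hl
    refine ⟨l, hl, ?_⟩
    obtain ⟨t1, h1, h1'⟩ := returns_run (l.take a) (node 0 0 1 0 leaf leaf)
    rw [h1, branch_eq] at h
    split at h
    · rename_i hav
      obtain ⟨t2, h2, h2'⟩ := returns_run ((l.drop a).take b) (node 0 0 1 0 leaf leaf)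
      rw [h2] at h
      obtain ⟨t3, h3, h3'⟩ := returns_prod t1 t2
      rw [h3] at h
      obtain ⟨t4, h4, h4'⟩ := returns_run ((l.drop a).drop b) t3
      rw [h4, decide_eq_true_iff] at h
      simp only [h4', h3', h2', h1', sum, Nat.cast_one, Nat.cast_zero, sub_zero, one_mul, add_zero] at h
      rw [← h]
      have e := sum_evalProgram_of_avoids hav
        (evalProgram (base : ℤ) (fun _ => 1) ((l.drop a).drop b))
      simp only [h1', sum, Nat.cast_one, Nat.cast_zero, sub_zero, one_mul, add_zero] at e
      rw [← e, ← evalProgram_append, ← evalProgram_append, List.append_assoc,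
        List.take_append_drop, List.take_append_drop]
    · simp at h

/-! ### State sums of words with free ends -/

/-- The matching `m` of the slots `σ`, with free slots `f`, describes the same partition of the
strands into pairs as the labels `ℓ`, which are less than `k`. -/
structure IsCode (ℓ : ℕ → ℕ) (m : ℕ) (σ f : List ℕ) (k : ℕ) : Prop where
  nodup : (σ ++ f).Nodup
  lt_slots : ∀ p ∈ σ ++ f, p < 32
  digit_free : ∀ p ∈ f, digit m p = 0
  digit_mem : ∀ p ∈ σ, digit m p ∈ σ
  digit_ne : ∀ p ∈ σ, digit m p ≠ p
  label_lt : ∀ p ∈ σ, ℓ p < k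
  label_eq_iff : ∀ p ∈ σ, ∀ q ∈ σ, ℓ p = ℓ q ↔ q = p ∨ q = digit m p

namespace IsCode

variable {ℓ : ℕ → ℕ} {m k p q : ℕ} {σ A t f : List ℕ}

theorem label_digit (h : IsCode ℓ m σ f k) (hp : p ∈ σ) : ℓ (digit m p) = ℓ p :=
  ((h.label_eq_iff p hp _ (h.digit_mem p hp)).2 (.inr rfl)).symm

theorem digit_digit (h : IsCode ℓ m σ f k) (hp : p ∈ σ) : digit m (digit m p) = p := by
  rcases (h.label_eq_iff _ (h.digit_mem p hp) p hp).1 (h.label_digit hp) with h1 | h1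
  · exact absurd h1.symm (h.digit_ne p hp)
  · exact h1.symm

theorem swap (h : IsCode ℓ m (A ++ p :: q :: t) f k) : IsCode ℓ m (A ++ q :: p :: t) f k := by
  have e : ∀ x, x ∈ A ++ q :: p :: t ↔ x ∈ A ++ p :: q :: t := fun x => by
    simp only [List.mem_append, List.mem_cons]; tauto
  refine ⟨?_, fun x hx => h.lt_slots x ?_, h.digit_free, ?_, ?_, ?_, ?_⟩
  · have := h.nodup
    simp only [List.nodup_append, List.nodup_cons, List.mem_append, List.mem_cons] at this ⊢
    grind
  · rw [List.mem_append] at hx ⊢; rwa [e] at hx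
  · simpa only [e] using h.digit_mem
  · simpa only [e] using h.digit_ne
  · simpa only [e] using h.label_lt
  · simpa only [e] using h.label_eq_iff

theorem pair (h : IsCode ℓ m (A ++ t) (p :: q :: f) k) :
    IsCode (fun c => if c = p ∨ c = q then k else ℓ c) (pair m p q) (A ++ p :: q :: t) f
      (k + 1) := by
  have hn := h.nodup
  simp only [List.nodup_append, List.nodup_cons, List.mem_append, List.mem_cons] at hn
  have hpq : p ≠ q := by grind
  have hd := digit_pair (m := m) (h.lt_slots p (by simp)) (h.lt_slots q (by simp)) hpq
    (h.digit_free p (by simp)) (h.digit_free q (by simp))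
  have hpσ : p ∉ A ++ t := by grind
  have hqσ : q ∉ A ++ t := by grind
  have e : ∀ x, x ∈ A ++ p :: q :: t ↔ x = p ∨ x = q ∨ x ∈ A ++ t := fun x => by
    simp only [List.mem_append, List.mem_cons]; tauto
  have hmem := h.digit_mem
  have hne := h.digit_ne
  have hlt := h.label_lt
  have heq := h.label_eq_iff
  have hfree := h.digit_free
  refine ⟨?_, fun x hx => h.lt_slots x ?_, ?_, ?_, ?_, ?_, ?_⟩
  · simp only [List.nodup_append, List.nodup_cons, List.mem_append, List.mem_cons]
    grind
  · simp only [List.mem_append, List.mem_cons] at hx ⊢; tauto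
  · grind
  · grind
  · grind
  · grind
  · intro x hx y hy
    rw [e] at hx hy
    grind

/-- The relabelling is the one made by `curvesFrom` at a maximum. If `p` and `q` belong to one arc,
its label disappears with them; otherwise the far ends of their arcs become partners. -/
theorem join (h : IsCode ℓ m (A ++ p :: q :: t) f k) :
    IsCode (fun c => if ℓ c = ℓ q then ℓ p else ℓ c) (join m p q) (A ++ t) (p :: q :: f) k := by
  have hn := h.nodup
  simp only [List.nodup_append, List.nodup_cons, List.mem_append, List.mem_cons] at hn
  have hpq : p ≠ q := by grind
  have e : ∀ x, x ∈ A ++ p :: q :: t ↔ x = p ∨ x = q ∨ x ∈ A ++ t := fun x => by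
    simp only [List.mem_append, List.mem_cons]; tauto
  have hp : p ∈ A ++ p :: q :: t := by simp
  have hq : q ∈ A ++ p :: q :: t := by simp
  have hd := digit_join (h.lt_slots p (by simp)) (h.lt_slots q (by simp)) hpq
    (h.digit_digit hp) (h.digit_digit hq) (h.digit_ne p hp) (h.digit_ne q hq)
  have hpσ : p ∉ A ++ t := by grind
  have hqσ : q ∉ A ++ t := by grind
  have hmem := h.digit_mem
  have hne := h.digit_ne
  have hlt := h.label_lt
  have heq := h.label_eq_iff
  have hfree := h.digit_free
  have hdd : ∀ x ∈ A ++ p :: q :: t, digit m (digit m x) = x := fun x hx => h.digit_digit hx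
  refine ⟨?_, fun x hx => h.lt_slots x ?_, ?_, ?_, ?_, ?_, ?_⟩
  · simp only [List.nodup_append, List.nodup_cons, List.mem_append, List.mem_cons]
    grind
  · simp only [List.mem_append, List.mem_cons] at hx ⊢; tauto
  · have : ∀ x ∈ f, x ∉ A ++ p :: q :: t := by grind
    intro x hx
    rw [hd]
    grind
  · intro x hx
    have hx' := (e x).2 (.inr (.inr hx))
    have h1 := (e _).1 (hmem x hx')
    have h2 := (e _).1 (hmem p hp)
    have h3 := (e _).1 (hmem q hq)
    rw [hd]
    grind
  · intro x hx
    have hx' := (e x).2 (.inr (.inr hx))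
    rw [hd]
    grind
  · grind
  · intro x hx y hy
    have hx' := (e x).2 (.inr (.inr hx))
    have hy' := (e y).2 (.inr (.inr hy))
    have h1 := heq x hx' y hy'
    have h2 := heq p hp x hx'
    have h3 := heq q hq x hx'
    have h4 := heq p hp y hy'
    have h5 := heq q hq y hy'
    have h6 := hdd x hx'
    have h7 := hdd y hy'
    have h8 := hdd p hp
    have h9 := hdd q hq
    rw [hd]
    clear hd hn hmem hne hlt heq hfree hdd e hx' hy' hp hq
    grind

end IsCode

open LaurentPolynomial in
/-- The state sum of a word whose lower ends are joined as the labels `s` say. -/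
noncomputable def stateSum (w : Word) (s : List ℕ) (k : ℕ) : ℤ[T;T⁻¹] :=
  ((states w).map fun b => T b.2 * d ^ curvesFrom b.1 s k).sum

open LaurentPolynomial in
theorem stateSum_cons (l : Layer) (w : Word) (s : List ℕ) (k : ℕ) :
    stateSum (l :: w) s k = ((smoothings l).map fun a => T a.2 *
      ((states w).map fun b => T b.2 * d ^ curvesFrom (a.1 ++ b.1) s k).sum).sum := by
  simp only [stateSum, states]
  induction smoothings l with
  | nil => rfl
  | cons a as ih =>
    simp only [List.flatMap_cons, List.map_append, List.sum_append, ih, List.map_map,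
      List.map_cons, List.sum_cons, ← List.sum_map_mul_left, Function.comp_def, T_add, mul_assoc]

theorem stateSum_nil (s : List ℕ) (k : ℕ) : stateSum [] s k = 1 := by
  simp [stateSum, states, curvesFrom]

theorem stateSum_cup (i : ℕ) (w : Word) (s : List ℕ) (k : ℕ) :
    stateSum (cup i :: w) s k = stateSum w (s.take i ++ k :: k :: s.drop i) (k + 1) := by
  rw [stateSum_cons]
  simp [smoothings, curvesFrom, stateSum]

theorem curvesFrom_cap (w : Word) (A t : List ℕ) (a b k : ℕ) :
    curvesFrom (cap A.length :: w) (A ++ a :: b :: t) k =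
      (if a = b then 1 else 0) + curvesFrom w ((A ++ t).map fun c => if c = b then a else c) k := by
  simp [curvesFrom]

theorem curvesFrom_cup (w : Word) (A t : List ℕ) (k : ℕ) :
    curvesFrom (cup A.length :: w) (A ++ t) k = curvesFrom w (A ++ k :: k :: t) (k + 1) := by
  simp [curvesFrom]

theorem curvesFrom_cap_cup (w : Word) (A t : List ℕ) (a b k : ℕ) :
    curvesFrom (cap A.length :: cup A.length :: w) (A ++ a :: b :: t) k =
      (if a = b then 1 else 0) + curvesFrom w ((A.map fun c => if c = b then a else c) ++
        k :: k :: t.map fun c => if c = b then a else c) (k + 1) := by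
  have := curvesFrom_cup w (A.map fun c => if c = b then a else c)
    (t.map fun c => if c = b then a else c) k
  rw [List.length_map] at this
  rw [curvesFrom_cap, List.map_append, this]

theorem stateSum_cap (w : Word) (A t : List ℕ) (a b k : ℕ) :
    stateSum (cap A.length :: w) (A ++ a :: b :: t) k =
      (if a = b then d else 1) *
        stateSum w ((A ++ t).map fun c => if c = b then a else c) k := by
  rw [stateSum_cons]
  simp only [smoothings, List.cons_append, List.nil_append, curvesFrom_cap,
    stateSum, List.map_cons, List.map_nil, List.sum_cons, List.sum_nil, ← List.sum_map_mul_left]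
  split <;> simp [pow_add, mul_left_comm]

theorem stateSum_virt (w : Word) (A t : List ℕ) (a b k : ℕ) :
    stateSum (cross .virt A.length :: w) (A ++ a :: b :: t) k =
      stateSum w (A ++ b :: a :: t) k := by
  rw [stateSum_cons]
  simp [smoothings, curvesFrom, stateSum]

/-- The state sum after a local maximum and a local minimum. -/
theorem sum_states_cap_cup (w : Word) (A t : List ℕ) (a b k : ℕ) :
    ((states w).map fun x => LaurentPolynomial.T x.2 *
      d ^ curvesFrom ([cap A.length, cup A.length] ++ x.1) (A ++ a :: b :: t) k).sum =
      (if a = b then d else 1) * stateSum w ((A.map fun c => if c = b then a else c) ++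
        k :: k :: t.map fun c => if c = b then a else c) (k + 1) := by
  simp only [List.cons_append, List.nil_append, curvesFrom_cap_cup, stateSum,
    ← List.sum_map_mul_left]
  split <;> simp [pow_add, mul_left_comm]

open LaurentPolynomial in
theorem stateSum_over (w : Word) (A t : List ℕ) (a b k : ℕ) :
    stateSum (cross .over A.length :: w) (A ++ a :: b :: t) k =
      T 1 * stateSum w (A ++ a :: b :: t) k + T (-1) * ((if a = b then d else 1) *
        stateSum w ((A.map fun c => if c = b then a else c) ++
          k :: k :: t.map fun c => if c = b then a else c) (k + 1)) := by
  rw [stateSum_cons, smoothings]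
  simp only [List.map_cons, List.map_nil, List.sum_cons, List.sum_nil, sum_states_cap_cup,
    add_zero]
  rfl

open LaurentPolynomial in
theorem stateSum_under (w : Word) (A t : List ℕ) (a b k : ℕ) :
    stateSum (cross .under A.length :: w) (A ++ a :: b :: t) k =
      T (-1) * stateSum w (A ++ a :: b :: t) k + T 1 * ((if a = b then d else 1) *
        stateSum w ((A.map fun c => if c = b then a else c) ++
          k :: k :: t.map fun c => if c = b then a else c) (k + 1)) := by
  rw [stateSum_cons, smoothings]
  simp only [List.map_cons, List.map_nil, List.sum_cons, List.sum_nil, sum_states_cap_cup,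
    add_zero]
  exact add_comm _ _

/-- The exponent of the unit by which the state sums of a word and of its program differ. -/
def shift : Word → ℤ
  | [] => 0
  | (.cap, _) :: w => 2 + shift w
  | (.cross .over, _) :: w => 1 + shift w
  | (.cross .under, _) :: w => 3 + shift w
  | _ :: w => shift w

-- This is `A^(-2) * d = -(1 + (A^(-2))^2)`, the reason why the program needs only nonnegative
-- powers of `r`.
open LaurentPolynomial in
theorem capWeight_T (x q : ℕ) :
    capWeight (T (-2) : ℤ[T;T⁻¹]) x q = T (-2) * if x = q then d else 1 := by
  unfold capWeight
  split
  · rw [d, mul_sub, mul_neg, ← T_add, ← T_add, T_pow]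
    norm_num
    ring
  · rw [mul_one]

theorem Crossing.eq_virt_or (c : Crossing) : c = .virt ∨ c = .over ∨ c = .under := by
  cases c <;> simp

theorem exists_eq_of_drop {σ t : List ℕ} {i p q : ℕ} (h : σ.drop i = p :: q :: t) :
    ∃ A, σ = A ++ p :: q :: t ∧ A.length = i ∧ σ.take i = A := by
  refine ⟨σ.take i, by rw [← h, List.take_append_drop], ?_, rfl⟩
  have : i < σ.length := by
    by_contra hi
    rw [List.drop_eq_nil_of_le (not_lt.1 hi)] at h
    simp at h
  simp [this.le]

theorem IsCode.map_pair {ℓ : ℕ → ℕ} {m k p q : ℕ} {A t f : List ℕ}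
    (h : IsCode ℓ m (A ++ t) (p :: q :: f) k) :
    (A ++ p :: q :: t).map (fun c => if c = p ∨ c = q then k else ℓ c) =
      A.map ℓ ++ k :: k :: t.map ℓ := by
  have hn := h.nodup
  simp only [List.nodup_append, List.nodup_cons, List.mem_append, List.mem_cons] at hn
  have h1 : A.map (fun c => if c = p ∨ c = q then k else ℓ c) = A.map ℓ :=
    List.map_congr_left fun c hc => if_neg (by grind)
  have h2 : t.map (fun c => if c = p ∨ c = q then k else ℓ c) = t.map ℓ :=
    List.map_congr_left fun c hc => if_neg (by grind)
  simp [h1, h2]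

theorem IsCode.eq_iff {ℓ : ℕ → ℕ} {m k p q : ℕ} {A t f : List ℕ}
    (h : IsCode ℓ m (A ++ p :: q :: t) f k) : ℓ p = ℓ q ↔ digit m p = q := by
  have hn := h.nodup
  simp only [List.nodup_append, List.nodup_cons, List.mem_append, List.mem_cons] at hn
  rw [h.label_eq_iff p (by simp) q (by simp)]
  grind

-- Each layer is renormalised to a polynomial in `r = A^(-2)`, and `shift` collects the units. A
-- maximum gives `A^2`; an over-crossing is `A * (1 + r * H)` and an under-crossing `A^3 * (r^2 + r
-- * H)`, where `H` is the horizontal smoothing.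
open LaurentPolynomial in
theorem stateSum_eq {w : Word} {σ f : List ℕ} {l : List Instr} (hl : compile w σ f = some l)
    {ℓ : ℕ → ℕ} {m k : ℕ} (h : IsCode ℓ m σ f k) :
    stateSum w (σ.map ℓ) k = T (shift w) * evalProgram (T (-2)) (fun _ => 1) l m := by
  induction w generalizing σ f l ℓ m k with
  | nil =>
    cases σ with
    | nil => simp only [compile, Option.some.injEq] at hl; subst hl; simp [stateSum_nil, shift, evalProgram]
    | cons => simp [compile] at hl
  | cons x w ih =>
    obtain ⟨x, i⟩ := x
    rcases x with _ | _ | c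
    · rcases f with _ | ⟨p, _ | ⟨q, f⟩⟩
      · simp [compile] at hl
      · simp [compile] at hl
      · simp only [compile, Option.map_eq_some_iff] at hl
        obtain ⟨l, hl, rfl⟩ := hl
        rw [← List.take_append_drop i σ] at h
        rw [stateSum_cup, ← List.map_take, ← List.map_drop, ← h.map_pair, ih hl h.pair]
        rfl
    · simp only [compile] at hl
      split at hl
      case h_2 => simp at hl
      case h_1 p q t ht =>
        obtain ⟨A, rfl, rfl, hA⟩ := exists_eq_of_drop ht
        rw [hA, Option.map_eq_some_iff] at hl
        obtain ⟨l, hl, rfl⟩ := hl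
        have key := stateSum_cap w (A.map ℓ) (t.map ℓ) (ℓ p) (ℓ q) k
        rw [List.length_map, ← List.map_append, List.map_map] at key
        rw [List.map_append, List.map_cons, List.map_cons, key]
        refine (congrArg _ (ih hl h.join)).trans ?_
        rw [shift, evalProgram, capWeight_T, T_add]
        simp only [h.eq_iff]
        have : (T 2 * T (-2) : ℤ[T;T⁻¹]) = 1 := by rw [← T_add]; exact T_zero
        linear_combination -(if digit m p = q then d else 1) * T (shift w) *
          evalProgram (T (-2)) (fun _ => 1) l (join m p q) * this
    · simp only [compile] at hl
      split at hl
      case h_2 => simp at hl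
      case h_1 p q t ht =>
        obtain ⟨A, rfl, rfl, hA⟩ := exists_eq_of_drop ht
        rw [hA] at hl
        rcases c.eq_virt_or with rfl | rfl | rfl
        · have key := stateSum_virt w (A.map ℓ) (t.map ℓ) (ℓ p) (ℓ q) k
          rw [List.length_map] at key
          rw [List.map_append, List.map_cons, List.map_cons, key, shift, ← ih hl h.swap]
          · simp
          all_goals simp
        · simp only [Option.map_eq_some_iff] at hl
          obtain ⟨l, hl, rfl⟩ := hl
          have key := stateSum_over w (A.map ℓ) (t.map ℓ) (ℓ p) (ℓ q) k
          rw [List.length_map, List.map_map, List.map_map] at key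
          have e1 := h.join.map_pair
          have e2 := ih hl h.join.pair
          rw [e1] at e2
          have e3 := ih hl h
          rw [List.map_append, List.map_cons, List.map_cons] at e3
          rw [List.map_append, List.map_cons, List.map_cons, key, e3]
          refine (congrArg (fun x => _ + _ * (_ * x)) e2).trans ?_
          rw [shift, evalProgram, capWeight_T, T_add]
          simp only [h.eq_iff, if_true]
          have : (T 1 * T (-2) : ℤ[T;T⁻¹]) = T (-1) := by rw [← T_add]; rfl
          linear_combination -(if digit m p = q then d else 1) * T (shift w) *
            evalProgram (T (-2)) (fun _ => 1) l (VirtualKnot.pair (join m p q) p q) * this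
        · simp only [Option.map_eq_some_iff] at hl
          obtain ⟨l, hl, rfl⟩ := hl
          have key := stateSum_under w (A.map ℓ) (t.map ℓ) (ℓ p) (ℓ q) k
          rw [List.length_map, List.map_map, List.map_map] at key
          have e1 := h.join.map_pair
          have e2 := ih hl h.join.pair
          rw [e1] at e2
          have e3 := ih hl h
          rw [List.map_append, List.map_cons, List.map_cons] at e3
          rw [List.map_append, List.map_cons, List.map_cons, key, e3]
          refine (congrArg (fun x => _ + _ * (_ * x)) e2).trans ?_
          rw [shift, evalProgram, capWeight_T, T_add]
          simp only [h.eq_iff, Bool.false_eq_true, if_false]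
          have h1 : (T 3 * T (-2) : ℤ[T;T⁻¹]) = T 1 := by rw [← T_add]; rfl
          have h2 : (T 3 * T (-2) ^ 2 : ℤ[T;T⁻¹]) = T (-1) := by rw [T_pow, ← T_add]; rfl
          linear_combination -(if digit m p = q then d else 1) * T (shift w) *
            evalProgram (T (-2)) (fun _ => 1) l (VirtualKnot.pair (join m p q) p q) * h1 -
            T (shift w) * evalProgram (T (-2)) (fun _ => 1) l m * h2

/-- Compilation succeeds only if no strand stays open at the top, so an open strand must finally
become part of a closed curve. This makes the truncated subtraction in `d ^ (|s| - 1)` harmless. -/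
theorem curvesFrom_pos {w : Word} {σ f : List ℕ} {l : List Instr} (hl : compile w σ f = some l)
    {ℓ : ℕ → ℕ} {m k : ℕ} (h : IsCode ℓ m σ f k) (hσ : σ ≠ []) :
    ∀ b ∈ states w, 1 ≤ curvesFrom b.1 (σ.map ℓ) k := by
  induction w generalizing σ f l ℓ m k with
  | nil =>
    cases σ with
    | nil => exact absurd rfl hσ
    | cons => simp [compile] at hl
  | cons x w ih =>
    obtain ⟨x, i⟩ := x
    rcases x with _ | _ | c
    · rcases f with _ | ⟨p, _ | ⟨q, f⟩⟩
      · simp [compile] at hl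
      · simp [compile] at hl
      · simp only [compile, Option.map_eq_some_iff] at hl
        obtain ⟨l, hl, rfl⟩ := hl
        rw [← List.take_append_drop i σ] at h
        simp only [states, smoothings, List.flatMap_cons, List.flatMap_nil, List.append_nil,
          List.mem_map]
        rintro _ ⟨b, hb, rfl⟩
        have := ih hl h.pair (by simp) b hb
        rwa [h.map_pair, List.map_take, List.map_drop] at this
    · simp only [compile] at hl
      split at hl
      case h_2 => simp at hl
      case h_1 p q t ht =>
        obtain ⟨A, rfl, rfl, hA⟩ := exists_eq_of_drop ht
        rw [hA, Option.map_eq_some_iff] at hl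
        obtain ⟨l, hl, rfl⟩ := hl
        simp only [states, smoothings, List.flatMap_cons, List.flatMap_nil, List.append_nil,
          List.mem_map]
        rintro _ ⟨b, hb, rfl⟩
        have key := curvesFrom_cap b.1 (A.map ℓ) (t.map ℓ) (ℓ p) (ℓ q) k
        rw [List.length_map, ← List.map_append, List.map_map] at key
        rw [List.map_append, List.map_cons, List.map_cons]
        simp only [List.cons_append, List.nil_append]
        rw [key]
        by_cases e : ℓ p = ℓ q
        · simp [e]
        -- If the maximum closes no curve, the partner of `p` is neither `p` nor `q`, so a strand
        -- remains and the induction continues.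
        · refine le_add_left (ih hl h.join (fun hAt => ?_) b hb)
          have hx := h.digit_mem p (by simp)
          have hx1 := h.digit_ne p (by simp)
          have hx2 := mt h.eq_iff.2 e
          rw [List.append_eq_nil_iff] at hAt
          rw [hAt.1, hAt.2] at hx
          simp at hx
          tauto
    · simp only [compile] at hl
      split at hl
      case h_2 => simp at hl
      case h_1 p q t ht =>
        obtain ⟨A, rfl, rfl, hA⟩ := exists_eq_of_drop ht
        rw [hA] at hl
        have smooth {l} (hl : compile w (A ++ p :: q :: t) f = some l) :
            ∀ b ∈ states w, 1 ≤ curvesFrom ([cap A.length, cup A.length] ++ b.1)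
              ((A ++ p :: q :: t).map ℓ) k := fun b hb => by
          have key := curvesFrom_cap_cup b.1 (A.map ℓ) (t.map ℓ) (ℓ p) (ℓ q) k
          rw [List.length_map, List.map_map, List.map_map] at key
          have := ih hl h.join.pair (by simp) b hb
          rw [h.join.map_pair] at this
          rw [List.map_append, List.map_cons, List.map_cons]
          exact (le_add_left this).trans key.ge
        rcases c.eq_virt_or with rfl | rfl | rfl
        · simp only [states, smoothings, List.flatMap_cons, List.flatMap_nil, List.append_nil,
            List.mem_map]
          rintro _ ⟨b, hb, rfl⟩
          have := ih hl h.swap (by simp) b hb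
          simpa [curvesFrom] using this
        all_goals
          simp only [Option.map_eq_some_iff] at hl
          obtain ⟨l, hl, -⟩ := hl
          simp only [states, smoothings, List.flatMap_cons, List.flatMap_nil, List.append_nil,
            List.mem_append, List.mem_map]
          rintro _ (⟨b, hb, rfl⟩ | ⟨b, hb, rfl⟩)
          · first | exact smooth hl b hb | exact ih hl h hσ b hb
          · first | exact smooth hl b hb | exact ih hl h hσ b hb

theorem isCode_nil {f : List ℕ} (hf : f.Nodup) (hf' : ∀ p ∈ f, p < 32) :
    IsCode id 0 [] f 0 := by
  refine ⟨by simpa using hf, by simpa using hf', fun p _ => ?_, ?_, ?_, ?_, ?_⟩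
  · simp [digit, Nat.zero_shiftRight]
  all_goals simp

open LaurentPolynomial in
/-- The bracket polynomial of a diagram, computed by its program. -/
theorem bracket_mul_d {w : Word} {i : ℕ} {f : List ℕ} {l : List Instr} (hf : f.Nodup)
    (hf' : ∀ p ∈ f, p < 32) (hl : compile (cup i :: w) [] f = some l) :
    bracket (cup i :: w) * d =
      T (shift (cup i :: w)) * evalProgram (T (-2)) (fun _ => 1) l 0 := by
  have h0 := isCode_nil hf hf'
  rw [← stateSum_eq hl h0, bracket, stateSum, ← List.sum_map_mul_right]
  refine congrArg List.sum (List.map_congr_left fun b hb => ?_)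
  -- There is no open strand at the start, so positivity is applied after the initial minimum.
  have hb' : 1 ≤ curvesFrom b.1 [] 0 := by
    rcases f with _ | ⟨p, _ | ⟨q, f⟩⟩
    · simp [compile] at hl
    · simp [compile] at hl
    · simp only [compile, Option.map_eq_some_iff] at hl
      obtain ⟨l, hl, rfl⟩ := hl
      simp only [states, smoothings, List.flatMap_cons, List.flatMap_nil, List.append_nil,
        List.mem_map] at hb
      obtain ⟨b, hb, rfl⟩ := hb
      have h1 : IsCode id 0 (([] : List ℕ).take i ++ ([] : List ℕ).drop i) (p :: q :: f) 0 := by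
        simpa using h0
      have := curvesFrom_pos hl h1.pair (by simp) b hb
      rw [h1.map_pair] at this
      simpa [curvesFrom] using this
  rw [List.map_nil, Word.curves, mul_assoc, ← pow_succ, Nat.sub_add_cancel hb']

/-! ### Polynomials with bounded coefficients -/

open Polynomial

/-- All coefficients of `p` have absolute value at most `B`. -/
def Bounded (p : ℤ[X]) (B : ℕ) : Prop := ∀ i, |p.coeff i| ≤ B

theorem Bounded.add {p q : ℤ[X]} {B B' : ℕ} (hp : Bounded p B) (hq : Bounded q B') :
    Bounded (p + q) (B + B') := fun i => by
  rw [coeff_add]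
  push_cast
  exact (abs_add_le _ _).trans (add_le_add (hp i) (hq i))

theorem Bounded.neg {p : ℤ[X]} {B : ℕ} (hp : Bounded p B) : Bounded (-p) B := fun i => by
  rw [coeff_neg, abs_neg]; exact hp i

theorem Bounded.X_pow_mul {p : ℤ[X]} {B : ℕ} (hp : Bounded p B) (n : ℕ) :
    Bounded (X ^ n * p) B := fun i => by
  rw [coeff_X_pow_mul']
  split
  · exact hp _
  · simp

theorem Bounded.mono {p : ℤ[X]} {B B' : ℕ} (hp : Bounded p B) (h : B ≤ B') : Bounded p B' :=
  fun i => (hp i).trans (by exact_mod_cast h)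

theorem Bounded.loop_mul {p : ℤ[X]} {B : ℕ} (hp : Bounded p B) :
    Bounded (-(1 + X ^ 2) * p) (B + B) := by
  have := (hp.add (hp.X_pow_mul 2)).neg
  rwa [show -(p + X ^ 2 * p) = -(1 + X ^ 2) * p by ring] at this

theorem Bounded.capWeight_mul {p : ℤ[X]} {B : ℕ} (hp : Bounded p B) (x q : ℕ) :
    Bounded (capWeight X x q * p) (B + B) := by
  unfold capWeight
  split
  · exact hp.loop_mul
  · simpa using (hp.X_pow_mul 1).mono (Nat.le_add_right B B)

/-- A bound for the coefficients of the state sum of a word. -/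
def coeffBound : Word → ℕ
  | [] => 1
  | (.cup, _) :: w => coeffBound w
  | (.cap, _) :: w => 2 * coeffBound w
  | (.cross .virt, _) :: w => coeffBound w
  | (.cross _, _) :: w => 3 * coeffBound w

/-- The weight of a maximum has coefficients of total absolute value at most 2, and a crossing adds
one vertical term, which gives the factors 2 and 3. -/
theorem bounded_evalProgram {w : Word} {σ f : List ℕ} {l : List Instr}
    (h : compile w σ f = some l) (m : ℕ) :
    Bounded (evalProgram X (fun _ => 1) l m) (coeffBound w) := by
  induction w generalizing σ f l m with
  | nil =>
    cases σ
    · simp only [compile, Option.some.injEq] at h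
      subst h
      intro i
      simp only [evalProgram, coeff_one, coeffBound]
      split <;> simp
    · simp [compile] at h
  | cons x w ih =>
    obtain ⟨_ | _ | _ | _ | _, i⟩ := x <;> simp only [compile] at h <;> split at h <;>
      try simp only [Option.map_eq_some_iff, reduceCtorEq] at h
    · obtain ⟨l, hl, rfl⟩ := h
      exact ih hl _
    · obtain ⟨l, hl, rfl⟩ := h
      exact ((ih hl _).capWeight_mul _ _).mono (Nat.two_mul _).ge
    · obtain ⟨l, hl, rfl⟩ := h
      simp only [evalProgram, if_true, one_mul]
      exact ((ih hl m).add ((ih hl _).capWeight_mul _ _)).mono (by simp only [coeffBound]; omega)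
    · obtain ⟨l, hl, rfl⟩ := h
      simp only [evalProgram, Bool.false_eq_true, if_false]
      exact (((ih hl m).X_pow_mul 2).add ((ih hl _).capWeight_mul _ _)).mono
        (by simp only [coeffBound]; omega)
    · exact ih h m

/-- If all lower coefficients vanish, dividing by the power of `X` shows that `N` divides the next
coefficient, which is smaller than `N` in absolute value and hence zero. -/
theorem eq_zero_of_eval_eq_zero {p : ℤ[X]} {B N : ℕ} (hp : Bounded p B) (hB : B < N)
    (h : p.eval (N : ℤ) = 0) : p = 0 := by
  ext i
  rw [coeff_zero]
  induction i using Nat.strong_induction_on with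
  | _ i ih =>
    obtain ⟨g, hg⟩ : (X ^ i : ℤ[X]) ∣ p := X_pow_dvd_iff.2 ih
    have hN : (N : ℤ) ≠ 0 := by exact_mod_cast (Nat.zero_le B |>.trans_lt hB).ne'
    have h0 : g.eval (N : ℤ) = 0 := by
      rw [hg, eval_mul, eval_pow, eval_X] at h
      exact (mul_eq_zero.1 h).resolve_left (pow_ne_zero _ hN)
    have h1 : p.coeff i = g.coeff 0 := by rw [hg, coeff_X_pow_mul']; simp
    have h2 : (N : ℤ) ∣ p.coeff i := by
      have := sub_dvd_eval_sub (N : ℤ) 0 g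
      rw [h0, ← coeff_zero_eq_eval_zero, ← h1] at this
      simpa using this
    exact Int.eq_zero_of_abs_lt_dvd h2 ((hp i).trans_lt (by exact_mod_cast hB))

/-- The polynomial with given coefficients, that of lowest degree first. -/
noncomputable def ofCoeffs : List ℤ → ℤ[X]
  | [] => 0
  | c :: L => C c + X * ofCoeffs L

theorem bounded_ofCoeffs {L : List ℤ} {B : ℕ} (h : ∀ c ∈ L, |c| ≤ B) :
    Bounded (ofCoeffs L) B := by
  induction L with
  | nil => intro i; simp [ofCoeffs]
  | cons c L ih =>
    rintro (_ | i)
    · simpa [ofCoeffs] using h c (by simp)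
    · simpa [ofCoeffs, coeff_C_succ, -eq_intCast, -map_intCast] using ih (fun c hc => h c (by simp [hc])) i

/-- The value of `ofCoeffs L` at `base`. -/
def hornerBase (L : List ℤ) : ℤ := L.foldr (fun c x => c + base * x) 0

theorem eval_ofCoeffs (L : List ℤ) : (ofCoeffs L).eval (base : ℤ) = hornerBase L := by
  induction L with
  | nil => simp [ofCoeffs, hornerBase]
  | cons c L ih => simp [ofCoeffs, ih, hornerBase]

open LaurentPolynomial in
/-- The Laurent polynomial with given coefficients at `T e`, `T (e - 2)`, `T (e - 4)` and so on. -/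
noncomputable def descending : List ℤ → ℤ → ℤ[T;T⁻¹]
  | [], _ => 0
  | c :: L, e => (c : ℤ[T;T⁻¹]) * T e + descending L (e - 2)

open LaurentPolynomial in
theorem T_mul_eval₂_ofCoeffs (L : List ℤ) (e : ℤ) :
    T e * eval₂ (Int.castRingHom ℤ[T;T⁻¹]) (T (-2)) (ofCoeffs L) = descending L e := by
  induction L generalizing e with
  | nil => simp [ofCoeffs, descending]
  | cons c L ih =>
    rw [descending, ← ih, sub_eq_add_neg, T_add, ofCoeffs, eval₂_add, eval₂_mul, Polynomial.eval₂_X,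
      Polynomial.eval₂_C]
    simp only [eq_intCast]
    ring

-- The state sum is `d` times the bracket, up to a unit. As `d = -(1 + r^2) * A^2`, a bracket with
-- highest listed exponent `e` appears in the program as `-(1 + r^2) * r^n * ofCoeffs L` with `2 * n
-- = shift w - 2 - e`. The bound on `coeffBound` lifts the checked equality at `base` to `ℤ[X]`.
open LaurentPolynomial in
theorem bracket_eq_of_check {w : Word} {f : List ℕ} {a b n : ℕ} {L : List ℤ} {e : ℤ}
    (B : ℕ) (hw : ∃ i w', w = cup i :: w') (hf : f.Nodup) (hf' : ∀ p ∈ f, p < 32) (hL : ∀ c ∈ L, |c| ≤ B)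
    (hB : coeffBound w + (B + B) < base) (he : e = shift w - 2 - 2 * n)
    (h : check w f a b (-(1 + (base : ℤ) ^ 2) * ((base : ℤ) ^ n * hornerBase L)) =
      true) :
    bracket w = descending L e := by
  obtain ⟨i, w', rfl⟩ := hw
  obtain ⟨l, hl, hv⟩ := evalProgram_of_check h
  have hp : evalProgram X (fun _ => 1) l 0 = -(1 + X ^ 2) * (X ^ n * ofCoeffs L) := by
    refine sub_eq_zero.1 (eq_zero_of_eval_eq_zero (B := coeffBound (cup i :: w') + (B + B)) ?_ hB ?_)
    · rw [sub_eq_add_neg]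
      exact (bounded_evalProgram hl 0).add ((bounded_ofCoeffs hL).X_pow_mul n).loop_mul.neg
    · have h1 := map_evalProgram (evalRingHom (base : ℤ)) X (fun _ => 1) l 0
      have h2 : ⇑(evalRingHom (base : ℤ)) ∘ (fun _ : ℕ => (1 : ℤ[X])) = fun _ => 1 := by
        funext; simp
      rw [h2, coe_evalRingHom, eval_X, hv] at h1
      simp [h1, eval_ofCoeffs]
  have h1 := map_evalProgram (eval₂RingHom (Int.castRingHom ℤ[T;T⁻¹]) (T (-2))) X (fun _ => 1) l 0
  have h2 : ⇑(eval₂RingHom (Int.castRingHom ℤ[T;T⁻¹]) (T (-2))) ∘ (fun _ : ℕ => (1 : ℤ[X])) =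
      fun _ => 1 := by
    funext; simp
  rw [h2, hp, coe_eval₂RingHom, Polynomial.eval₂_X] at h1
  have h3 := bracket_mul_d hf hf' hl
  rw [← h1] at h3
  -- At `A = 1` the value of `d` is `-2`.
  have hd : d ≠ 0 := fun h0 => by
    have := congrArg (LaurentPolynomial.eval₂ (RingHom.id ℤ) 1) h0
    simp [d] at this
  refine mul_right_cancel₀ hd (h3.trans ?_)
  rw [← T_mul_eval₂_ofCoeffs, he]
  have h4 : (T (shift (cup i :: w')) : ℤ[T;T⁻¹]) =
      T (shift (cup i :: w') - 2 - 2 * n) * T 2 * T (2 * n) := by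
    rw [← T_add, ← T_add]; congr 1; ring
  have h5 : (T (2 * n) * T (-2) ^ n : ℤ[T;T⁻¹]) = 1 := by
    rw [T_pow, ← T_add, ← T_zero]; congr 1; ring
  have h6 : (T 2 * T (-2) : ℤ[T;T⁻¹]) = 1 := by rw [← T_add]; exact T_zero
  simp only [eval₂_mul, eval₂_neg, eval₂_add, Polynomial.eval₂_one, eval₂_pow, Polynomial.eval₂_X,
    d]
  rw [h4]
  linear_combination
    -T (shift (cup i :: w') - 2 - 2 * n) * T 2 * (1 + T (-2) ^ 2) *
      Polynomial.eval₂ (Int.castRingHom ℤ[T;T⁻¹]) (T (-2)) (ofCoeffs L) * h5 -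
    T (shift (cup i :: w') - 2 - 2 * n) * T (-2) *
      Polynomial.eval₂ (Int.castRingHom ℤ[T;T⁻¹]) (T (-2)) (ofCoeffs L) * h6

/-! ### The brackets of the unknot and of `K_D` -/

open LaurentPolynomial

theorem descending_d : descending [-1, 0, -1] 2 = d := by
  simp [descending, d]
  ring

theorem descending_d_sq : descending [1, 0, 2, 0, 1] 4 = d ^ 2 := by
  simp only [descending, d, sq, mul_sub, sub_mul, neg_mul, mul_neg, ← T_add]
  norm_num
  ring

theorem unknot_bracket : unknot.bracket = 1 := by
  refine (bracket_eq_of_check (f := [0, 1]) (a := 0) (b := 0) (n := 0) (L := [1]) (e := 0) 1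
    ⟨0, _, rfl⟩ ?_ ?_ ?_ ?_ ?_ ?_).trans ?_
  any_goals decide +kernel
  simp [descending]

theorem unknot_strandBracket_two : unknot.strandBracket 2 = d := by
  refine (bracket_eq_of_check (f := [0, 1, 2, 3]) (a := 0) (b := 0) (n := 0) (L := [-1, 0, -1])
    (e := 2) 1 ⟨0, _, rfl⟩ ?_ ?_ ?_ ?_ ?_ ?_).trans descending_d
  all_goals decide +kernel

theorem unknot_strandBracket_three : unknot.strandBracket 3 = d ^ 2 := by
  refine (bracket_eq_of_check (f := [0, 1, 2, 3, 4, 5]) (a := 0) (b := 0) (n := 0)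
    (L := [1, 0, 2, 0, 1]) (e := 4) 2 ⟨0, _, rfl⟩ ?_ ?_ ?_ ?_ ?_ ?_).trans descending_d_sq
  all_goals decide +kernel

theorem KD_bracket : KD.bracket = 1 := by
  refine (bracket_eq_of_check (f := [0, 1, 2, 3, 4, 5]) (a := 0) (b := 0) (n := 12)
    (L := [1]) (e := 0) 1 ⟨0, _, rfl⟩ ?_ ?_ ?_ ?_ ?_ ?_).trans ?_
  any_goals decide +kernel
  simp [descending]

theorem KD_strandBracket_two : KD.strandBracket 2 = d := by
  refine (bracket_eq_of_check (f := [0, 1, 2, 3, 4, 5, 6, 7, 8, 9, 10, 11]) (a := 0) (b := 0)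
    (n := 40) (L := [-1, 0, -1]) (e := 2) 1 ⟨0, _, rfl⟩ ?_ ?_ ?_ ?_ ?_ ?_).trans descending_d
  all_goals decide +kernel

/-- The coefficients of `⟨K_D⟩₃`. -/
def coeffsKD : List ℤ :=
   [
    -1, 0, 1, 2, 5, 10, 21, 25, 26, 22, 10, -16, -64, -116, -169, -209, -239, -225, -147, -1,
    198, 436, 700, 927, 1050, 981, 737, 238, -416, -1192, -1923, -2384, -2544, -2148, -1408,
    -241, 1064, 2233, 3099, 3320, 3099, 2233, 1064, -241, -1408, -2148, -2544, -2384, -1923,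
    -1192, -416, 238, 737, 981, 1050, 927, 700, 436, 198, -1, -147, -225, -239, -209, -169,
    -116, -64, -16, 10, 22, 26, 25, 21, 10, 5, 2, 1, 0, -1]

theorem KD_strandBracket_three_eq_descending : KD.strandBracket 3 = descending coeffsKD 78 := by
  -- Virtual crossings give no instruction. The first block has 3 + 6 + 36 + 6 = 51: the outer
  -- minima, then the minima, crossings and maxima of the first tangle. The second has 6 + 36 + 3 =
  -- 45 and stops before the maxima that join the second tangle to the first. Six strands remain
  -- from each block, with at most 15 matchings. The shift is 15 * 2 + 36 + 36 * 3 = 174, and 174 -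
  -- 2 - 2 * 47 = 78.
  refine bracket_eq_of_check (f := [12, 13, 14, 15, 16, 17, 0, 1, 2, 3, 4, 5, 6, 7, 8, 9, 10, 11])
    (a := 51) (b := 45) (n := 47) 10000 ⟨0, _, rfl⟩ ?_ ?_ ?_ ?_ ?_ ?_
  all_goals decide +kernel

theorem eval₂_descending {R : Type*} [CommRing R] (u : Rˣ) (L : List ℤ) (e : ℤ) :
    LaurentPolynomial.eval₂ (Int.castRingHom R) u (descending L e) =
      ((u ^ e : Rˣ) : R) * L.foldr (fun (c : ℤ) (x : R) => (c : R) + ((u ^ (-2 : ℤ) : Rˣ) : R) * x) 0 := by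
  induction L generalizing e with
  | nil => simp [descending]
  | cons c L ih =>
    simp only [descending, map_add, map_mul, map_intCast, eval₂_T, ih, List.foldr_cons,
      sub_eq_add_neg, zpow_add, Units.val_mul]
    ring

theorem descending_coeffsKD_ne : descending coeffsKD 78 ≠ d ^ 2 := fun h => by
  -- The two polynomials already differ at `A = 3` modulo 11, where the inverse of 3 is 4.
  have h1 := congrArg (LaurentPolynomial.eval₂ (Int.castRingHom (ZMod 11)) ⟨3, 4, rfl, rfl⟩) h
  rw [← descending_d_sq, eval₂_descending, eval₂_descending] at h1
  revert h1
  decide +kernel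

end VirtualKnot

/-! ### The main theorem -/

open VirtualKnot LaurentPolynomial in
theorem mainTheorem5 :
    (unknot.bracket = 1 ∧ unknot.strandBracket 2 = d ∧ unknot.strandBracket 3 = d ^ 2) ∧
    KD.bracket = 1 ∧
    KD.strandBracket 2 = d ∧
    KD.strandBracket 3 = d * (
          -1842 + (T 76 + T (-76)) - 2 * (T 72 + T (-72)) - 2 * (T 70 + T (-70))
          - 3 * (T 68 + T (-68)) - 8 * (T 66 + T (-66)) - 18 * (T 64 + T (-64))
          - 17 * (T 62 + T (-62)) - 8 * (T 60 + T (-60)) - 5 * (T 58 + T (-58))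
          - 2 * (T 56 + T (-56)) + 21 * (T 54 + T (-54)) + 66 * (T 52 + T (-52))
          + 95 * (T 50 + T (-50)) + 103 * (T 48 + T (-48)) + 114 * (T 46 + T (-46))
          + 136 * (T 44 + T (-44)) + 111 * (T 42 + T (-42)) + 11 * (T 40 + T (-40))
          - 110 * (T 38 + T (-38)) - 209 * (T 36 + T (-36)) - 326 * (T 34 + T (-34))
          - 491 * (T 32 + T (-32)) - 601 * (T 30 + T (-30)) - 559 * (T 28 + T (-28))
          - 380 * (T 26 + T (-26)) - 178 * (T 24 + T (-24)) + 142 * (T 22 + T (-22))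
          + 594 * (T 20 + T (-20)) + 1050 * (T 18 + T (-18)) + 1329 * (T 16 + T (-16))
          + 1334 * (T 14 + T (-14)) + 1215 * (T 12 + T (-12)) + 814 * (T 10 + T (-10))
          + 193 * (T 8 + T (-8)) - 573 * (T 6 + T (-6)) - 1257 * (T 4 + T (-4))
          - 1660 * (T 2 + T (-2))) ∧
    KD.strandBracket 3 ≠ d ^ 2 ∧
    ¬ VirtuallyEquivalent KD unknot := by
  refine ⟨⟨unknot_bracket, unknot_strandBracket_two, unknot_strandBracket_three⟩, KD_bracket,
    KD_strandBracket_two, ?_, ?_, not_virtuallyEquivalent_KD_unknot⟩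
  · rw [KD_strandBracket_three_eq_descending]
    simp only [descending, coeffsKD, d, mul_add, mul_sub, sub_mul, neg_mul, ← T_add]
    norm_num
    ring
  · rw [KD_strandBracket_three_eq_descending]
    exact descending_coeffsKD_ne
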